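/- Let $n\ge 3$, let $I\subseteq\mathbb R$ be a non-empty open interval, $\rho>0$, and $M=I\times\mathbb B^n(\rho)\subset\mathbb R\times\mathbb R^n$, where $\mathbb B^n(\rho)$ is the open Euclidean ball of radius $\rho$ centred at $0$. Write points of $M$ as $x=(x^0,\overline x)$ and tangent vectors as $y=(y^0,\overline y)$, and let $|\cdot|$ be the Euclidean norm on $\mathbb R^n$. Let $F:TM\to[0,\infty)$ be a Finsler metric on $M$ (that is, $F$ is $C^\infty$ off the zero section, positively homogeneous of degree one in $y$, and $g_{AB}=\frac12[F^2]_{y^Ay^B}$ is positive definite for $y\ne0$) of the form $$F(x,y)=u\,\phi(x^0,r,z),\qquad u=|\overline y|,\quad r=|\overline x|,\quad z=\frac{y^0}{u}\qquad(\overline y\neq 0).$$ Let $G^A=Py^A+Q^A$ with $P=\frac{F_{x^C}y^C}{2F}$ and $Q^A=\frac F2 g^{AB}\{F_{x^Cy^B}y^C-F_{x^B}\}$ be the geodesic spray coefficients of $F$. Then $F$ has vanishing Berwald curvature, i.e. $\frac{\partial^3G^A}{\partial y^B\partial y^C\partial y^D}=0$ for all $A,B,C,D\in\{0,\dots,n\}$,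 all $x\in M$ and all $y\neq0$, if and only if one of the following holds: 1. $F$ is a Randers metric with vanishing Berwald curvature, where Randers means that $F=\alpha+\beta$ on $TM$ with $\alpha(x,y)=\sqrt{a_{AB}(x)y^Ay^B}$ a smooth Riemannian metric and $\beta=b_A(x)y^A$ a smooth $1$-form of $\alpha$-norm less than $1$ at every point ($\beta=0$, i.e. $F$ Riemannian, is allowed); 2. there are differentiable functions $g_1=g_1(x^0,r)$ and $g_2=g_2(x^0,r)$ on $I\times[0,\rho)$ such that $$-\frac{\phi_r}{r}=2(\phi-z\phi_z)\,g_1\quad(x^0\in I,\ 0<r<\rho,\ z\in\mathbb R),\qquad \phi_{x^0}=z\,\phi_z\,g_2\quad(x^0\in I,\ 0\le r<\rho,\ z\in\mathbb R).$$ -/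

import Mathlib

open Set
open scoped ContDiff Matrix

namespace FinslerCyl

/-- Partial derivative of `f` in the `A`-th coordinate direction, at the point `y`. -/
noncomputable def pd {m : ℕ} (A : Fin m) (f : (Fin m → ℝ) → ℝ) (y : Fin m → ℝ) : ℝ :=
  fderiv ℝ f y (Pi.single A 1)

/-- The fundamental tensor `g_{AB}(x, y) = (1/2) ∂²(F²)/∂y^A∂y^B`. -/
noncomputable def fundTensor {m : ℕ} (F : (Fin m → ℝ) → (Fin m → ℝ) → ℝ)
    (x y : Fin m → ℝ) : Matrix (Fin m) (Fin m) ℝ :=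
  Matrix.of fun A B => (1 / 2 : ℝ) * pd A (pd B fun v => F x v ^ 2) y

/-- `F` is a Finsler metric on the open set `M ⊆ ℝᵐ`, with `TM = M × ℝᵐ`: it is smooth off the
zero section, and it restricts to a Minkowski norm on every tangent space. -/
structure IsFinslerMetric {m : ℕ} (M : Set (Fin m → ℝ))
    (F : (Fin m → ℝ) → (Fin m → ℝ) → ℝ) : Prop where
  nonneg : ∀ x ∈ M, ∀ y, 0 ≤ F x y
  smooth : ContDiffOn ℝ ∞ (fun p : (Fin m → ℝ) × (Fin m → ℝ) => F p.1 p.2) (M ×ˢ {0}ᶜ)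
  homogeneous : ∀ x ∈ M, ∀ y, ∀ c : ℝ, 0 < c → F x (c • y) = c * F x y
  posDef : ∀ x ∈ M, ∀ y, y ≠ 0 → (fundTensor F x y).PosDef

/-- `P = F_{x^C} y^C / (2F)`. -/
noncomputable def sprayP {m : ℕ} (F : (Fin m → ℝ) → (Fin m → ℝ) → ℝ) (x y : Fin m → ℝ) : ℝ :=
  (∑ C, pd C (fun w => F w y) x * y C) / (2 * F x y)

/-- `Q^A = (F/2) g^{AB} (F_{x^C y^B} y^C - F_{x^B})`. -/
noncomputable def sprayQ {m : ℕ} (F : (Fin m → ℝ) → (Fin m → ℝ) → ℝ) (x : Fin m → ℝ)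
    (A : Fin m) (y : Fin m → ℝ) : ℝ :=
  F x y / 2 * ∑ B, (fundTensor F x y)⁻¹ A B *
    ((∑ C, pd B (fun v => pd C (fun w => F w v) x) y * y C) - pd B (fun w => F w y) x)

/-- The geodesic spray coefficients `G^A = P y^A + Q^A`. -/
noncomputable def spray {m : ℕ} (F : (Fin m → ℝ) → (Fin m → ℝ) → ℝ) (x : Fin m → ℝ)
    (A : Fin m) (y : Fin m → ℝ) : ℝ :=
  sprayP F x y * y A + sprayQ F x A y

/-- The Berwald curvature `B^A_{BCD} = ∂³G^A/∂y^B∂y^C∂y^D`. -/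
noncomputable def berwaldCurvature {m : ℕ} (F : (Fin m → ℝ) → (Fin m → ℝ) → ℝ)
    (x y : Fin m → ℝ) (A B C D : Fin m) : ℝ :=
  pd B (pd C (pd D (spray F x A))) y

/-- `F` has vanishing Berwald curvature on `M` (off the zero section). -/
def IsBerwald {m : ℕ} (M : Set (Fin m → ℝ)) (F : (Fin m → ℝ) → (Fin m → ℝ) → ℝ) : Prop :=
  ∀ x ∈ M, ∀ y, y ≠ 0 → ∀ A B C D, berwaldCurvature F x y A B C D = 0

/-- `F = α + β` is a Randers metric on `M`: `α(x, y) = √(a_{AB}(x) y^A y^B)` is a (smooth)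
Riemannian metric and `β = b_A(x) y^A` a smooth 1-form whose `α`-norm is less than 1 at every
point, that is, `|β(x, y)| < α(x, y)` for all `y ≠ 0`. Riemannian metrics (`β = 0`) are
included. -/
def IsRanders {m : ℕ} (M : Set (Fin m → ℝ)) (F : (Fin m → ℝ) → (Fin m → ℝ) → ℝ) : Prop :=
  ∃ (a : (Fin m → ℝ) → Matrix (Fin m) (Fin m) ℝ) (b : (Fin m → ℝ) → Fin m → ℝ),
    (∀ A B, ContDiffOn ℝ ∞ (fun x => a x A B) M) ∧
    (∀ A, ContDiffOn ℝ ∞ (fun x => b x A) M) ∧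
    (∀ x ∈ M, (a x).PosDef) ∧
    (∀ x ∈ M, ∀ y, y ≠ 0 → |b x ⬝ᵥ y| < √(y ⬝ᵥ (a x *ᵥ y))) ∧
    ∀ x ∈ M, ∀ y, F x y = √(y ⬝ᵥ (a x *ᵥ y)) + b x ⬝ᵥ y

/-- The part `(x¹, …, xⁿ)` of `x = (x⁰, x¹, …, xⁿ)`, as a vector of Euclidean space. -/
def bar {n : ℕ} (x : Fin (n + 1) → ℝ) : EuclideanSpace ℝ (Fin n) :=
  WithLp.toLp 2 (Fin.tail x)

/-- The manifold `I × 𝔹ⁿ(ρ) ⊆ ℝ × ℝⁿ`. -/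
def cyl (n : ℕ) (I : Set ℝ) (ρ : ℝ) : Set (Fin (n + 1) → ℝ) :=
  {x | x 0 ∈ I ∧ ‖bar x‖ < ρ}

/-- `φ(x⁰, r, z)` satisfies `-φ_r / r = 2 (φ - z φ_z) g₁` and `φ_{x⁰} = z φ_z g₂`, for some
differentiable functions `g₁`, `g₂` of `(x⁰, r) ∈ I × [0, ρ)`; the first equation is meant for
`r > 0`, since it divides by `r`. -/
def SatisfiesBerwaldPDE (I : Set ℝ) (ρ : ℝ) (φ : ℝ → ℝ → ℝ → ℝ) : Prop :=
  ∃ g₁ g₂ : ℝ → ℝ → ℝ,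
    DifferentiableOn ℝ (fun p : ℝ × ℝ => g₁ p.1 p.2) (I ×ˢ Ico 0 ρ) ∧
    DifferentiableOn ℝ (fun p : ℝ × ℝ => g₂ p.1 p.2) (I ×ˢ Ico 0 ρ) ∧
    (∀ t ∈ I, ∀ r ∈ Ioo 0 ρ, ∀ z : ℝ,
      -(deriv (fun r' => φ t r' z) r) / r
        = 2 * (φ t r z - z * deriv (fun z' => φ t r z') z) * g₁ t r) ∧
    (∀ t ∈ I, ∀ r ∈ Ico 0 ρ, ∀ z : ℝ,
      deriv (fun t' => φ t' r z) t = z * deriv (fun z' => φ t r z') z * g₂ t r)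

end FinslerCyl

/-! Being Berwald at `x` amounts to the existence of symmetric coefficients Γ with F_{x^B} = F_{y^A}
Γ^A_{BC} y^C for all y ≠ 0. The forward direction (`exists_connection`) follows by differentiating
F_{y^A} G^A = ½ F_{x^C} y^C in y and using that the second derivatives of the spray are constant;
conversely such a Γ forces G^A = ½ Γ^A_{BC} y^B y^C (`spray_eq`), whose third derivatives vanish.

By rotational symmetry it suffices to look at points (t, s, 0, …, 0) and vectors (a, b, 0, …, 0),
where F is even in b. The part of the connection equation that is odd in b reads Γ^0_{B1} b F_{y^0}
+ Γ^1_{B0} a F_{y^1} = 0. If some coefficient here is nonzero, this is an ODE whose solutions are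
Euclidean norms (`sq_eq_of_dependent`). Otherwise the connection is diagonal on the slice: F_{x^0} =
α a F_{y^0} and F_{x^1} = δ b F_{y^1} (`isEuclideanAt_or`).

The alternative is global. Rescale both axes to unit F-length and square the defect of F² from a² +
b². At Euclidean points this square has a double zero, and at diagonal points the rescaling absorbs
the connection, so its derivative vanishes everywhere (`hasDerivAt_normalized`). One Euclidean point
thus makes F Riemannian. Without any, the diagonal equations hold throughout and become the two
equations for φ, with g₂ = α and g₁ = -δ/(2r); evaluating on the axes expresses α and δ through F,
and parity in r gives differentiability at r = 0 (`satisfiesBerwaldPDE`).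

Conversely, the two equations provide an explicit symmetric connection preserving F
(`isBerwald_of_satisfiesBerwaldPDE`). -/

namespace FinslerCyl

/-! ### Coordinate derivatives and Euler identities. -/

section PartialDerivatives

variable {m : ℕ} {f g : (Fin m → ℝ) → ℝ} {y : Fin m → ℝ}

theorem hasDerivAt_pd (hf : DifferentiableAt ℝ f y) (A : Fin m) :
    HasDerivAt (fun s : ℝ => f (y + s • Pi.single A (1 : ℝ))) (pd A f y) 0 := by
  have h1 : HasDerivAt (fun s : ℝ => y + s • Pi.single A (1 : ℝ)) (Pi.single A (1 : ℝ)) 0 := by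
    simpa using ((hasDerivAt_id (0 : ℝ)).smul_const (Pi.single A (1 : ℝ))).const_add y
  have h2 : HasFDerivAt f (fderiv ℝ f y) (y + (0 : ℝ) • Pi.single A (1 : ℝ)) := by
    simpa using hf.hasFDerivAt
  exact h2.comp_hasDerivAt (0 : ℝ) h1

theorem pd_eq_of_hasDerivAt (hf : DifferentiableAt ℝ f y) {A : Fin m} {d : ℝ}
    (h : HasDerivAt (fun s : ℝ => f (y + s • Pi.single A (1 : ℝ))) d 0) : pd A f y = d :=
  (hasDerivAt_pd hf A).unique h

theorem pd_congr (h : f =ᶠ[nhds y] g) (A : Fin m) : pd A f y = pd A g y := by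
  rw [pd, pd, h.fderiv_eq]

theorem pd_const (A : Fin m) (c : ℝ) : pd A (fun _ => c) y = 0 := by
  simp [pd]

theorem pd_coord (A B : Fin m) :
    pd A (fun v : Fin m → ℝ => v B) y = (1 : Matrix (Fin m) (Fin m) ℝ) A B := by
  have h : HasFDerivAt (fun v : Fin m → ℝ => v B)
      (ContinuousLinearMap.proj (R := ℝ) (φ := fun _ : Fin m => ℝ) B) y :=
    (ContinuousLinearMap.proj (R := ℝ) (φ := fun _ : Fin m => ℝ) B).hasFDerivAt
  rw [pd, h.fderiv]
  simp [Matrix.one_apply, Pi.single_apply, eq_comm]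

theorem pd_sub (hf : DifferentiableAt ℝ f y) (hg : DifferentiableAt ℝ g y) (A : Fin m) :
    pd A (fun v => f v - g v) y = pd A f y - pd A g y := by
  simp [pd, fderiv_fun_sub hf hg]

theorem pd_mul (hf : DifferentiableAt ℝ f y) (hg : DifferentiableAt ℝ g y) (A : Fin m) :
    pd A (fun v => f v * g v) y = pd A f y * g y + f y * pd A g y := by
  simp [pd, fderiv_fun_mul hf hg]
  ring

theorem pd_const_mul (c : ℝ) (hf : DifferentiableAt ℝ f y) (A : Fin m) :
    pd A (fun v => c * f v) y = c * pd A f y := by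
  rw [pd_mul (differentiableAt_const c) hf, pd_const]
  ring

theorem pd_sum {ι : Type*} (s : Finset ι) {f : ι → (Fin m → ℝ) → ℝ}
    (hf : ∀ i ∈ s, DifferentiableAt ℝ (f i) y) (A : Fin m) :
    pd A (fun v => ∑ i ∈ s, f i v) y = ∑ i ∈ s, pd A (f i) y := by
  simp [pd, fderiv_fun_sum hf]

theorem differentiableAt_coord (B : Fin m) :
    DifferentiableAt ℝ (fun v : Fin m → ℝ => v B) y :=
  differentiableAt_apply B y

theorem fderiv_apply_eq_sum_pd (v : Fin m → ℝ) : fderiv ℝ f y v = ∑ A, v A * pd A f y := by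
  conv_lhs => rw [← Finset.univ_sum_single v]
  rw [map_sum]
  refine Finset.sum_congr rfl fun A _ => ?_
  have : Pi.single A (v A) = v A • (Pi.single A 1 : Fin m → ℝ) := by
    rw [← Pi.single_smul]; simp
  rw [this, map_smul, smul_eq_mul, pd]

theorem fderiv_eq_zero_of_pd (h : ∀ A, pd A f y = 0) : fderiv ℝ f y = 0 := by
  ext v
  simp [fderiv_apply_eq_sum_pd, h]

theorem contDiffAt_pd (hf : ContDiffAt ℝ ∞ f y) (A : Fin m) : ContDiffAt ℝ ∞ (pd A f) y :=
  (hf.fderiv_right (m := ∞) (by simp)).clm_apply contDiffAt_const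

theorem pd_comm (hf : ContDiffAt ℝ ∞ f y) (A B : Fin m) :
    pd A (pd B f) y = pd B (pd A f) y := by
  have hd : DifferentiableAt ℝ (fderiv ℝ f) y :=
    (hf.fderiv_right (m := ∞) (by simp)).differentiableAt (by simp)
  have key : ∀ A B : Fin m, pd A (pd B f) y
      = fderiv ℝ (fderiv ℝ f) y (Pi.single A 1) (Pi.single B 1) := by
    intro A B
    have : pd B f = fun v => fderiv ℝ f v (Pi.single B 1) := rfl
    rw [this, pd, fderiv_clm_apply hd (differentiableAt_const _)]
    simp
  rw [key, key]
  exact hf.isSymmSndFDerivAt (by simpa using ENat.LEInfty.out) _ _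

/-- Euler's identity for functions that are positively homogeneous of degree one. -/
theorem euler_one (hf : DifferentiableAt ℝ f y) (h : ∀ c : ℝ, 0 < c → f (c • y) = c * f y) :
    ∑ A, y A * pd A f y = f y := by
  have h1 : HasDerivAt (fun c : ℝ => c • y) y 1 := by
    simpa using (hasDerivAt_id (1 : ℝ)).smul_const y
  have h2 : HasFDerivAt f (fderiv ℝ f y) ((1 : ℝ) • y) := by simpa using hf.hasFDerivAt
  have h3 := h2.comp_hasDerivAt (1 : ℝ) h1
  have h4 : HasDerivAt (fun c : ℝ => c * f y) (f y) 1 := by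
    simpa using (hasDerivAt_id (1 : ℝ)).mul_const (f y)
  have h5 : (f ∘ fun c : ℝ => c • y) =ᶠ[nhds 1] fun c => c * f y := by
    filter_upwards [lt_mem_nhds (zero_lt_one' ℝ)] with c hc using h c hc
  rw [← fderiv_apply_eq_sum_pd]
  exact h3.unique (h4.congr_of_eventuallyEq h5)

/-- Euler's identity for functions that are positively homogeneous of degree zero. -/
theorem euler_zero (hf : DifferentiableAt ℝ f y) (h : ∀ c : ℝ, 0 < c → f (c • y) = f y) :
    ∑ A, y A * pd A f y = 0 := by
  have h1 : HasDerivAt (fun c : ℝ => c • y) y 1 := by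
    simpa using (hasDerivAt_id (1 : ℝ)).smul_const y
  have h2 : HasFDerivAt f (fderiv ℝ f y) ((1 : ℝ) • y) := by simpa using hf.hasFDerivAt
  have h3 := h2.comp_hasDerivAt (1 : ℝ) h1
  have h4 : HasDerivAt (fun _ : ℝ => f y) 0 1 := hasDerivAt_const _ _
  have h5 : (f ∘ fun c : ℝ => c • y) =ᶠ[nhds 1] fun _ => f y := by
    filter_upwards [lt_mem_nhds (zero_lt_one' ℝ)] with c hc using h c hc
  rw [← fderiv_apply_eq_sum_pd]
  exact h3.unique (h4.congr_of_eventuallyEq h5)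

theorem pd_smul_of_homogeneous (h : ∀ v, ∀ c : ℝ, 0 < c → f (c • v) = c * f v) (A : Fin m)
    {c : ℝ} (hc : 0 < c) : pd A f (c • y) = pd A f y := by
  have h1 : fderiv ℝ (fun v => f (c • v)) y = c • fderiv ℝ f (c • y) := fderiv_comp_smul c
  have h2 : (fun v => f (c • v)) = fun v => c • f v := funext fun v => h v c hc
  rw [h2, show (fun v => c • f v) = c • f from rfl, fderiv_const_smul_field] at h1
  have h3 := smul_right_injective _ hc.ne' h1
  rw [pd, pd, h3]

/-- Cramer's rule: the adjugate entries are themselves determinants, hence polynomial in the entries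
of the matrix. -/
theorem contDiffAt_inv_apply {E : Type*} [NormedAddCommGroup E] [NormedSpace ℝ E] {p : E}
    {M : E → Matrix (Fin m) (Fin m) ℝ} (hM : ∀ A B, ContDiffAt ℝ ∞ (fun v => M v A B) p)
    (hdet : (M p).det ≠ 0) (A B : Fin m) : ContDiffAt ℝ ∞ (fun v => (M v)⁻¹ A B) p := by
  have det_smooth : ∀ N : E → Matrix (Fin m) (Fin m) ℝ,
      (∀ A B, ContDiffAt ℝ ∞ (fun v => N v A B) p) → ContDiffAt ℝ ∞ (fun v => (N v).det) p := by
    intro N hN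
    simp only [Matrix.det_apply]
    exact ContDiffAt.sum fun σ _ => (contDiffAt_prod fun i _ => hN _ _).const_smul _
  have h : (fun v => (M v)⁻¹ A B) = fun v => (M v).det⁻¹ * (M v).adjugate A B := by
    funext v
    simp [Matrix.inv_def]
  rw [h]
  refine ((det_smooth M hM).inv hdet).mul ?_
  simp only [Matrix.adjugate_apply]
  refine det_smooth _ fun i j => ?_
  simp only [Matrix.updateRow_apply]
  split_ifs
  · exact contDiffAt_const
  · exact hM i j

end PartialDerivatives

/-! ### Contraction identities for a general Finsler metric and its spray. -/

section Finsler

variable {m : ℕ} {M : Set (Fin m → ℝ)} {F : (Fin m → ℝ) → (Fin m → ℝ) → ℝ}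
  {x y : Fin m → ℝ}

theorem IsFinslerMetric.contDiffAt (hF : IsFinslerMetric M F) (hM : IsOpen M) (hx : x ∈ M)
    (hy : y ≠ 0) : ContDiffAt ℝ ∞ (fun p : (Fin m → ℝ) × (Fin m → ℝ) => F p.1 p.2) (x, y) :=
  hF.smooth.contDiffAt ((hM.prod isOpen_compl_singleton).mem_nhds ⟨hx, hy⟩)

theorem IsFinslerMetric.contDiffAt_fiber (hF : IsFinslerMetric M F) (hM : IsOpen M) (hx : x ∈ M)
    (hy : y ≠ 0) : ContDiffAt ℝ ∞ (F x) y :=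
  (hF.contDiffAt hM hx hy).comp y (contDiffAt_const.prodMk contDiffAt_id)

theorem IsFinslerMetric.contDiffAt_base (hF : IsFinslerMetric M F) (hM : IsOpen M) (hx : x ∈ M)
    (hy : y ≠ 0) : ContDiffAt ℝ ∞ (fun w => F w y) x :=
  (hF.contDiffAt hM hx hy).comp x (contDiffAt_id.prodMk contDiffAt_const)

theorem IsFinslerMetric.contDiffAt_pd_base (hF : IsFinslerMetric M F) (hM : IsOpen M)
    (hx : x ∈ M) (hy : y ≠ 0) (C : Fin m) :
    ContDiffAt ℝ ∞ (fun v => pd C (fun w => F w v) x) y := by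
  have h : ContDiffAt ℝ ∞ (Function.uncurry fun v w => F w v) (y, x) :=
    (hF.contDiffAt hM hx hy).comp (y, x) (contDiffAt_snd.prodMk contDiffAt_fst)
  exact (ContDiffAt.fderiv h (contDiffAt_const (c := x)) (m := ∞) (by simp)).clm_apply
    contDiffAt_const

theorem IsFinslerMetric.fundTensor_apply (hF : IsFinslerMetric M F) (hM : IsOpen M) (hx : x ∈ M)
    (hy : y ≠ 0) (A B : Fin m) :
    fundTensor F x y A B = pd A (F x) y * pd B (F x) y + F x y * pd A (pd B (F x)) y := by
  have hd : ∀ v, v ≠ 0 → DifferentiableAt ℝ (F x) v := fun v hv =>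
    (hF.contDiffAt_fiber hM hx hv).differentiableAt (by simp)
  have h1 : (pd B fun v => F x v ^ 2) =ᶠ[nhds y] fun v => 2 * (F x v * pd B (F x) v) := by
    filter_upwards [isOpen_compl_singleton.mem_nhds hy] with v hv
    simp only [pow_two]
    rw [pd_mul (hd v hv) (hd v hv)]
    ring
  have hB : DifferentiableAt ℝ (pd B (F x)) y :=
    (contDiffAt_pd (hF.contDiffAt_fiber hM hx hy) B).differentiableAt (by simp)
  rw [fundTensor, Matrix.of_apply, pd_congr h1, pd_const_mul _ ((hd y hy).fun_mul hB),
    pd_mul (hd y hy) hB]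
  ring

theorem IsFinslerMetric.euler (hF : IsFinslerMetric M F) (hM : IsOpen M) (hx : x ∈ M)
    (hy : y ≠ 0) : ∑ A, y A * pd A (F x) y = F x y :=
  euler_one ((hF.contDiffAt_fiber hM hx hy).differentiableAt (by simp))
    fun c hc => hF.homogeneous x hx y c hc

theorem IsFinslerMetric.euler_pd (hF : IsFinslerMetric M F) (hM : IsOpen M) (hx : x ∈ M)
    (hy : y ≠ 0) (B : Fin m) : ∑ A, y A * pd A (pd B (F x)) y = 0 :=
  euler_zero ((contDiffAt_pd (hF.contDiffAt_fiber hM hx hy) B).differentiableAt (by simp))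
    fun _ hc => pd_smul_of_homogeneous (hF.homogeneous x hx) B hc

theorem IsFinslerMetric.pd_base_smul (hF : IsFinslerMetric M F) (hM : IsOpen M) (hx : x ∈ M)
    (hy : y ≠ 0) (C : Fin m) {c : ℝ} (hc : 0 < c) :
    pd C (fun w => F w (c • y)) x = c * pd C (fun w => F w y) x := by
  have h : (fun w => F w (c • y)) =ᶠ[nhds x] fun w => c * F w y := by
    filter_upwards [hM.mem_nhds hx] with w hw using hF.homogeneous w hw y c hc
  rw [pd_congr h, pd_const_mul _ ((hF.contDiffAt_base hM hx hy).differentiableAt (by simp))]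

theorem IsFinslerMetric.euler_base (hF : IsFinslerMetric M F) (hM : IsOpen M) (hx : x ∈ M)
    (hy : y ≠ 0) (C : Fin m) :
    ∑ A, y A * pd A (fun v => pd C (fun w => F w v) x) y = pd C (fun w => F w y) x :=
  euler_one ((hF.contDiffAt_pd_base hM hx hy C).differentiableAt (by simp))
    fun _ hc => hF.pd_base_smul hM hx hy C hc

theorem IsFinslerMetric.sum_fundTensor_mul (hF : IsFinslerMetric M F) (hM : IsOpen M)
    (hx : x ∈ M) (hy : y ≠ 0) (A : Fin m) :
    ∑ B, fundTensor F x y A B * y B = F x y * pd A (F x) y := by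
  simp only [hF.fundTensor_apply hM hx hy, pd_comm (hF.contDiffAt_fiber hM hx hy) A]
  have h1 := hF.euler hM hx hy
  have h2 := hF.euler_pd hM hx hy A
  calc ∑ B, (pd A (F x) y * pd B (F x) y + F x y * pd B (pd A (F x)) y) * y B
      = pd A (F x) y * ∑ B, y B * pd B (F x) y
        + F x y * ∑ B, y B * pd B (pd A (F x)) y := by
        rw [Finset.mul_sum, Finset.mul_sum, ← Finset.sum_add_distrib]
        exact Finset.sum_congr rfl fun B _ => by ring
    _ = F x y * pd A (F x) y := by rw [h1, h2]; ring

/-- Euler's identity gives g_{AB} y^A y^B = F², so definiteness of g excludes F = 0. -/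
theorem IsFinslerMetric.pos (hF : IsFinslerMetric M F) (hM : IsOpen M) (hx : x ∈ M)
    (hy : y ≠ 0) : 0 < F x y := by
  have h := (hF.posDef x hx y hy).dotProduct_mulVec_pos hy
  have h2 : fundTensor F x y *ᵥ y = fun A => F x y * pd A (F x) y :=
    funext fun A => hF.sum_fundTensor_mul hM hx hy A
  have h3 : y ⬝ᵥ (fun A => F x y * pd A (F x) y) = F x y * F x y := by
    conv_rhs => rhs; rw [← hF.euler hM hx hy]
    rw [dotProduct, Finset.mul_sum]
    exact Finset.sum_congr rfl fun B _ => by ring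
  rw [h2, star_trivial, h3] at h
  exact lt_of_le_of_ne (hF.nonneg x hx y) fun h0 => by simp [← h0] at h

theorem IsFinslerMetric.apply_zero (hF : IsFinslerMetric M F) (hx : x ∈ M) : F x 0 = 0 := by
  have := hF.homogeneous x hx 0 2 two_pos
  rw [smul_zero] at this
  linarith

theorem IsFinslerMetric.fundTensor_symm (hF : IsFinslerMetric M F) (hM : IsOpen M) (hx : x ∈ M)
    (hy : y ≠ 0) (A B : Fin m) : fundTensor F x y A B = fundTensor F x y B A := by
  rw [hF.fundTensor_apply hM hx hy, hF.fundTensor_apply hM hx hy,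
    pd_comm (hF.contDiffAt_fiber hM hx hy) A B]
  ring

theorem IsFinslerMetric.isUnit_det (hF : IsFinslerMetric M F) (hx : x ∈ M)
    (hy : y ≠ 0) : IsUnit (fundTensor F x y).det :=
  (hF.posDef x hx y hy).det_pos.ne'.isUnit

/-- The covector `F_{x^C y^B} y^C - F_{x^B}`. -/
noncomputable def sprayCovector (F : (Fin m → ℝ) → (Fin m → ℝ) → ℝ) (x y : Fin m → ℝ)
    (B : Fin m) : ℝ :=
  (∑ C, pd B (fun v => pd C (fun w => F w v) x) y * y C) - pd B (fun w => F w y) x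

theorem sprayQ_eq (A : Fin m) :
    sprayQ F x A y = F x y / 2 * ((fundTensor F x y)⁻¹ *ᵥ sprayCovector F x y) A := rfl

theorem IsFinslerMetric.sum_fundTensor_mul_sprayQ (hF : IsFinslerMetric M F) (hx : x ∈ M)
    (hy : y ≠ 0) (B : Fin m) :
    ∑ A, fundTensor F x y B A * sprayQ F x A y = F x y / 2 * sprayCovector F x y B := by
  have h : fundTensor F x y *ᵥ ((fundTensor F x y)⁻¹ *ᵥ sprayCovector F x y)
      = sprayCovector F x y := by
    rw [Matrix.mulVec_mulVec, Matrix.mul_nonsing_inv _ (hF.isUnit_det hx hy), Matrix.one_mulVec]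
  conv_rhs => rw [← h]
  rw [Matrix.mulVec, dotProduct, Finset.mul_sum]
  exact Finset.sum_congr rfl fun A _ => by rw [sprayQ_eq]; ring

/-- By Euler's identity for F_{x^C}, which has degree one in y, both terms contract to F_{x^C} y^C.
-/
theorem IsFinslerMetric.sum_sprayCovector_mul (hF : IsFinslerMetric M F) (hM : IsOpen M)
    (hx : x ∈ M) (hy : y ≠ 0) : ∑ B, sprayCovector F x y B * y B = 0 := by
  simp only [sprayCovector, sub_mul, Finset.sum_sub_distrib, Finset.sum_mul]
  rw [Finset.sum_comm, sub_eq_zero]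
  refine Finset.sum_congr rfl fun C _ => ?_
  rw [← hF.euler_base hM hx hy C, Finset.sum_mul]
  exact Finset.sum_congr rfl fun B _ => by ring

/-- Since F F_{y^A} = g_{AB} y^B, contracting with Q amounts to contracting the spray covector with
y. -/
theorem IsFinslerMetric.sum_pd_mul_sprayQ (hF : IsFinslerMetric M F) (hM : IsOpen M)
    (hx : x ∈ M) (hy : y ≠ 0) : ∑ A, pd A (F x) y * sprayQ F x A y = 0 := by
  have hpos := hF.pos hM hx hy
  have h : F x y * ∑ A, pd A (F x) y * sprayQ F x A y
      = F x y / 2 * ∑ B, sprayCovector F x y B * y B := by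
    calc F x y * ∑ A, pd A (F x) y * sprayQ F x A y
        = ∑ A, (∑ B, fundTensor F x y A B * y B) * sprayQ F x A y := by
          rw [Finset.mul_sum]
          refine Finset.sum_congr rfl fun A _ => ?_
          rw [hF.sum_fundTensor_mul hM hx hy]
          ring
      _ = ∑ B, (∑ A, fundTensor F x y B A * sprayQ F x A y) * y B := by
          simp only [Finset.sum_mul]
          rw [Finset.sum_comm]
          refine Finset.sum_congr rfl fun B _ => Finset.sum_congr rfl fun A _ => ?_
          rw [hF.fundTensor_symm hM hx hy A B]
          ring
      _ = _ := by
          rw [Finset.mul_sum]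
          refine Finset.sum_congr rfl fun B _ => ?_
          rw [hF.sum_fundTensor_mul_sprayQ hx hy]
          ring
  rw [hF.sum_sprayCovector_mul hM hx hy, mul_zero] at h
  exact (mul_eq_zero.mp h).resolve_left hpos.ne'

/-- Only the P-part contributes. The identity says that F is constant along its geodesics. -/
theorem IsFinslerMetric.sum_pd_mul_spray (hF : IsFinslerMetric M F) (hM : IsOpen M)
    (hx : x ∈ M) (hy : y ≠ 0) :
    ∑ A, pd A (F x) y * spray F x A y = (1 / 2) * ∑ C, pd C (fun w => F w y) x * y C := by
  have hpos := hF.pos hM hx hy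
  calc ∑ A, pd A (F x) y * spray F x A y
      = sprayP F x y * ∑ A, y A * pd A (F x) y + ∑ A, pd A (F x) y * sprayQ F x A y := by
        rw [Finset.mul_sum, ← Finset.sum_add_distrib]
        exact Finset.sum_congr rfl fun A _ => by rw [spray]; ring
    _ = _ := by
        rw [hF.euler hM hx hy, hF.sum_pd_mul_sprayQ hM hx hy, sprayP]
        field_simp
        ring

theorem IsFinslerMetric.contDiffAt_fundTensor (hF : IsFinslerMetric M F) (hM : IsOpen M)
    (hx : x ∈ M) (hy : y ≠ 0) (A B : Fin m) :
    ContDiffAt ℝ ∞ (fun v => fundTensor F x v A B) y :=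
  contDiffAt_const.mul
    (contDiffAt_pd (contDiffAt_pd ((hF.contDiffAt_fiber hM hx hy).pow 2) B) A)

theorem IsFinslerMetric.contDiffAt_spray (hF : IsFinslerMetric M F) (hM : IsOpen M)
    (hx : x ∈ M) (hy : y ≠ 0) (A : Fin m) : ContDiffAt ℝ ∞ (spray F x A) y := by
  have hf := hF.contDiffAt_fiber hM hx hy
  have hc : ∀ B : Fin m, ContDiffAt ℝ ∞ (fun v : Fin m → ℝ => v B) y := fun B =>
    (contDiff_apply ℝ ℝ B).contDiffAt
  have hb := hF.contDiffAt_pd_base hM hx hy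
  have hP : ContDiffAt ℝ ∞ (sprayP F x) y :=
    (ContDiffAt.sum fun C _ => (hb C).mul (hc C)).div (contDiffAt_const.mul hf)
      (mul_ne_zero two_ne_zero (hF.pos hM hx hy).ne')
  have hQ : ContDiffAt ℝ ∞ (sprayQ F x A) y :=
    (hf.div_const 2).mul (ContDiffAt.sum fun B _ =>
      (contDiffAt_inv_apply (hF.contDiffAt_fundTensor hM hx hy)
        (hF.isUnit_det hx hy).ne_zero A B).mul
      ((ContDiffAt.sum fun C _ => (contDiffAt_pd (hb C) B).mul (hc C)).sub (hb B)))
  exact (hP.mul (hc A)).add hQ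

/-- `F` is constant along the nonlinear connection `N^A_B = ∂G^A/∂y^B`. -/
theorem IsFinslerMetric.pd_base_eq (hF : IsFinslerMetric M F) (hM : IsOpen M)
    (hx : x ∈ M) (hy : y ≠ 0) (B : Fin m) :
    pd B (fun w => F w y) x = ∑ A, pd A (F x) y * pd B (spray F x A) y := by
  have hpos := hF.pos hM hx hy
  have hf := hF.contDiffAt_fiber hM hx hy
  have hG := hF.contDiffAt_spray hM hx hy
  have hb := hF.contDiffAt_pd_base hM hx hy
  have hd : ∀ {g : (Fin m → ℝ) → ℝ}, ContDiffAt ℝ ∞ g y → DifferentiableAt ℝ g y :=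
    fun h => h.differentiableAt (by simp)
  -- The claim comes from differentiating this identity in y^B.
  have e1 : (fun v => ∑ A, pd A (F x) v * spray F x A v) =ᶠ[nhds y]
      fun v => (1 / 2) * ∑ C, pd C (fun w => F w v) x * v C := by
    filter_upwards [isOpen_compl_singleton.mem_nhds hy] with v hv
    exact hF.sum_pd_mul_spray hM hx hv
  have e2 := pd_congr e1 B
  rw [pd_const_mul _ (DifferentiableAt.fun_sum fun C _ =>
      (hd (hb C)).fun_mul (differentiableAt_coord C)),
    pd_sum _ (fun A _ => (hd (contDiffAt_pd hf A)).fun_mul (hd (hG A))),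
    pd_sum _ (fun C _ => (hd (hb C)).fun_mul (differentiableAt_coord C))] at e2
  simp only [pd_mul (hd (contDiffAt_pd hf _)) (hd (hG _)),
    pd_mul (hd (hb _)) (differentiableAt_coord _), pd_coord, Finset.sum_add_distrib] at e2
  have e3 : ∑ C, pd C (fun w => F w y) x * (1 : Matrix (Fin m) (Fin m) ℝ) B C
      = pd B (fun w => F w y) x := by
    simp [Matrix.one_apply]
  have e4 : ∑ C, pd B (fun v => pd C (fun w => F w v) x) y * y C
      = sprayCovector F x y B + pd B (fun w => F w y) x := by
    rw [sprayCovector]; ring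
  -- The P-part drops out by Euler's identity for F_{y^B}; for the Q-part use F F_{y^A y^B} = g_{AB}
  -- - F_{y^A} F_{y^B}, where the last term contracts to zero.
  have e5 : ∑ A, pd B (pd A (F x)) y * spray F x A y = (1 / 2) * sprayCovector F x y B := by
    have h1 : ∑ A, pd B (pd A (F x)) y * spray F x A y
        = sprayP F x y * ∑ A, y A * pd A (pd B (F x)) y
          + ∑ A, pd B (pd A (F x)) y * sprayQ F x A y := by
      rw [Finset.mul_sum, ← Finset.sum_add_distrib]
      refine Finset.sum_congr rfl fun A _ => ?_
      rw [spray, pd_comm hf A B]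
      ring
    have h2 : F x y * ∑ A, pd B (pd A (F x)) y * sprayQ F x A y
        = ∑ A, fundTensor F x y B A * sprayQ F x A y
          - pd B (F x) y * ∑ A, pd A (F x) y * sprayQ F x A y := by
      rw [Finset.mul_sum, Finset.mul_sum, ← Finset.sum_sub_distrib]
      refine Finset.sum_congr rfl fun A _ => ?_
      rw [hF.fundTensor_apply hM hx hy]
      ring
    rw [hF.sum_pd_mul_sprayQ hM hx hy, hF.sum_fundTensor_mul_sprayQ hx hy] at h2
    rw [h1, hF.euler_pd hM hx hy]
    have h3 : ∑ A, pd B (pd A (F x)) y * sprayQ F x A y = 1 / 2 * sprayCovector F x y B :=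
      mul_left_cancel₀ hpos.ne' (by rw [h2]; ring)
    rw [h3]
    ring
  rw [e3, e4, e5] at e2
  linarith

end Finsler

/-! ### Vanishing Berwald curvature and torsion-free linear connections preserving F. -/

section Connection

variable {m : ℕ} {M : Set (Fin m → ℝ)} {F : (Fin m → ℝ) → (Fin m → ℝ) → ℝ}
  {x : Fin m → ℝ}

/-- In dimension at least two the complement of the origin is connected. -/
theorem eqOn_const_of_pd_eq_zero (hm : 1 < m) {f : (Fin m → ℝ) → ℝ}
    (hf : ∀ y, y ≠ 0 → DifferentiableAt ℝ f y) (h : ∀ y, y ≠ 0 → ∀ A, pd A f y = 0) :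
    ∃ c, ∀ y, y ≠ 0 → f y = c := by
  have hconn : IsConnected ({0}ᶜ : Set (Fin m → ℝ)) :=
    isConnected_compl_singleton_of_one_lt_rank (by simpa using hm) 0
  exact isOpen_compl_singleton.exists_is_const_of_fderiv_eq_zero hconn.isPreconnected
    (fun y hy => (hf y hy).differentiableWithinAt)
    (fun y hy => fderiv_eq_zero_of_pd (h y hy))

/-- If the Berwald curvature vanishes at `x`, then `F` is constant along a torsion-free linear
connection at `x`. -/
theorem IsFinslerMetric.exists_connection (hF : IsFinslerMetric M F) (hM : IsOpen M)
    (hx : x ∈ M) (hm : 1 < m)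
    (hB : ∀ y, y ≠ 0 → ∀ A B C D, berwaldCurvature F x y A B C D = 0) :
    ∃ Γ : Fin m → Fin m → Fin m → ℝ, (∀ A B C, Γ A B C = Γ A C B) ∧
      ∀ y, y ≠ 0 → ∀ B,
        pd B (fun w => F w y) x = ∑ A, pd A (F x) y * ∑ C, Γ A B C * y C := by
  have hG := fun (y) (hy : y ≠ 0) => hF.contDiffAt_spray hM hx hy
  have hd : ∀ {g : (Fin m → ℝ) → ℝ} {y : Fin m → ℝ}, ContDiffAt ℝ ∞ g y →
    DifferentiableAt ℝ g y := fun h => h.differentiableAt (by simp)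
  have h1 : ∀ A B C, ∃ c, ∀ y, y ≠ 0 → pd C (pd B (spray F x A)) y = c := fun A B C =>
    eqOn_const_of_pd_eq_zero hm (fun y hy => hd (contDiffAt_pd (contDiffAt_pd (hG y hy A) B) C))
      fun y hy D => hB y hy A D C B
  choose Γ hΓ using h1
  -- Constant second derivatives make the first derivatives of the spray affine in y.
  have h2 : ∀ A B, ∃ c, ∀ y, y ≠ 0 → pd B (spray F x A) y - ∑ C, Γ A B C * y C = c := by
    intro A B
    refine eqOn_const_of_pd_eq_zero hm
      (fun y hy => (hd (contDiffAt_pd (hG y hy A) B)).fun_sub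
        (DifferentiableAt.fun_sum fun C _ => (differentiableAt_coord C).const_mul _)) ?_
    intro y hy C
    rw [pd_sub (hd (contDiffAt_pd (hG y hy A) B))
        (DifferentiableAt.fun_sum fun C _ => (differentiableAt_coord C).const_mul _),
      pd_sum _ fun C _ => (differentiableAt_coord C).const_mul _]
    simp only [pd_const_mul _ (differentiableAt_coord _), pd_coord, hΓ A B C y hy]
    simp [Matrix.one_apply]
  choose c hc using h2
  have hone : (fun _ => 1 : Fin m → ℝ) ≠ 0 := fun h => one_ne_zero (congrFun h ⟨0, by omega⟩)
  refine ⟨Γ, fun A B C => ?_, fun y hy B => ?_⟩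
  · rw [← hΓ A B C _ hone, ← hΓ A C B _ hone, pd_comm (hG _ hone A)]
  -- The additive constants `c A B` are removed by scaling y: their contraction with F_{y^A} has
  -- degree zero, all other terms degree one. Comparing t = 1 with t = 2 shows that this contraction
  -- vanishes.
  · have h3 : ∀ t : ℝ, 0 < t → t * pd B (fun w => F w y) x
        = ∑ A, pd A (F x) y * c A B + t * ∑ A, pd A (F x) y * ∑ C, Γ A B C * y C := by
      intro t ht
      have hty : t • y ≠ 0 := smul_ne_zero ht.ne' hy
      rw [← hF.pd_base_smul hM hx hy B ht, hF.pd_base_eq hM hx hty, Finset.mul_sum,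
        ← Finset.sum_add_distrib]
      refine Finset.sum_congr rfl fun A _ => ?_
      rw [pd_smul_of_homogeneous (hF.homogeneous x hx) A ht,
        sub_eq_iff_eq_add.mp (hc A B _ hty)]
      have : ∑ C, Γ A B C * (t • y) C = t * ∑ C, Γ A B C * y C := by
        rw [Finset.mul_sum]
        exact Finset.sum_congr rfl fun C _ => by simp; ring
      rw [this]
      ring
    have h4 := h3 1 one_pos
    have h5 := h3 2 two_pos
    linarith

/-- The spray of a metric that is constant along a torsion-free linear connection. -/
theorem IsFinslerMetric.spray_eq (hF : IsFinslerMetric M F) (hM : IsOpen M)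
    (hx : x ∈ M) {Γ : Fin m → Fin m → Fin m → ℝ} (hΓ : ∀ A B C, Γ A B C = Γ A C B)
    (h : ∀ y, y ≠ 0 → ∀ B,
      pd B (fun w => F w y) x = ∑ A, pd A (F x) y * ∑ C, Γ A B C * y C)
    {y : Fin m → ℝ} (hy : y ≠ 0) (A : Fin m) :
    spray F x A y = (1 / 2) * ∑ B, y B * ∑ C, Γ A B C * y C := by
  have hpos := hF.pos hM hx hy
  have hf := hF.contDiffAt_fiber hM hx hy
  have hd : ∀ {g : (Fin m → ℝ) → ℝ}, ContDiffAt ℝ ∞ g y → DifferentiableAt ℝ g y :=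
    fun h => h.differentiableAt (by simp)
  set G : Fin m → ℝ := fun A => (1 / 2) * ∑ B, y B * ∑ C, Γ A B C * y C with hG
  set k : ℝ := ∑ A, pd A (F x) y * G A with hk
  have hN : ∀ A B, DifferentiableAt ℝ (fun v : Fin m → ℝ => ∑ C, Γ A B C * v C) y :=
    fun A B => DifferentiableAt.fun_sum fun C _ => (differentiableAt_coord C).const_mul _
  have hpN : ∀ A B D, pd D (fun v : Fin m → ℝ => ∑ C, Γ A B C * v C) y = Γ A B D := by
    intro A B D
    rw [pd_sum _ fun C _ => (differentiableAt_coord C).const_mul _]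
    simp only [pd_const_mul _ (differentiableAt_coord _), pd_coord]
    simp [Matrix.one_apply]
  have e1 : ∀ B C, pd B (fun v => pd C (fun w => F w v) x) y
      = ∑ A, (pd B (pd A (F x)) y * ∑ D, Γ A C D * y D + pd A (F x) y * Γ A C B) := by
    intro B C
    have : (fun v => pd C (fun w => F w v) x) =ᶠ[nhds y]
        fun v => ∑ A, pd A (F x) v * ∑ D, Γ A C D * v D := by
      filter_upwards [isOpen_compl_singleton.mem_nhds hy] with v hv using h v hv C
    rw [pd_congr this, pd_sum _ fun A _ => (hd (contDiffAt_pd hf A)).fun_mul (hN A C)]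
    refine Finset.sum_congr rfl fun A _ => ?_
    rw [pd_mul (hd (contDiffAt_pd hf A)) (hN A C), hpN]
  -- Symmetry of Γ lets the terms containing F_{y^A} cancel against F_{x^B}.
  have e2 : ∀ B, sprayCovector F x y B = 2 * ∑ A, pd B (pd A (F x)) y * G A := by
    intro B
    rw [sprayCovector, h y hy B]
    simp only [e1, Finset.sum_add_distrib, add_mul, Finset.sum_mul]
    have i1 : ∑ C, ∑ A, pd A (F x) y * Γ A C B * y C
        = ∑ A, pd A (F x) y * ∑ C, Γ A B C * y C := by
      rw [Finset.sum_comm]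
      refine Finset.sum_congr rfl fun A _ => ?_
      rw [Finset.mul_sum]
      exact Finset.sum_congr rfl fun C _ => by rw [hΓ A C B]; ring
    have i2 : ∑ C, ∑ A, (pd B (pd A (F x)) y * ∑ D, Γ A C D * y D) * y C
        = 2 * ∑ A, pd B (pd A (F x)) y * G A := by
      rw [Finset.sum_comm, Finset.mul_sum]
      refine Finset.sum_congr rfl fun A _ => ?_
      simp only [hG]
      rw [← mul_assoc, ← mul_assoc, Finset.mul_sum]
      exact Finset.sum_congr rfl fun C _ => by ring
    rw [i1, i2]
    ring
  -- Q is found by applying the invertible matrix g to the candidate G - (k/F) y; the correction is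
  -- exactly what P y restores.
  have e3 : fundTensor F x y *ᵥ (fun A => sprayQ F x A y)
      = fundTensor F x y *ᵥ (fun A => G A - k / F x y * y A) := by
    funext B
    rw [Matrix.mulVec, dotProduct, hF.sum_fundTensor_mul_sprayQ hx hy, e2, Matrix.mulVec,
      dotProduct]
    have j1 : ∑ A, fundTensor F x y B A * (G A - k / F x y * y A)
        = ∑ A, fundTensor F x y B A * G A
          - k / F x y * ∑ A, fundTensor F x y B A * y A := by
      rw [Finset.mul_sum, ← Finset.sum_sub_distrib]
      exact Finset.sum_congr rfl fun A _ => by ring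
    have j2 : ∑ A, fundTensor F x y B A * G A
        = pd B (F x) y * k + F x y * ∑ A, pd B (pd A (F x)) y * G A := by
      rw [hk, Finset.mul_sum, Finset.mul_sum, ← Finset.sum_add_distrib]
      refine Finset.sum_congr rfl fun A _ => ?_
      rw [hF.fundTensor_apply hM hx hy]
      ring
    rw [j1, j2, hF.sum_fundTensor_mul hM hx hy]
    field_simp
    ring
  have e4 := congrFun (Matrix.mulVec_injective_of_isUnit
    ((Matrix.isUnit_iff_isUnit_det _).mpr (hF.isUnit_det hx hy)) e3) A
  have e5 : sprayP F x y = k / F x y := by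
    have : ∑ C, pd C (fun w => F w y) x * y C = 2 * k := by
      simp only [h y hy, hk, hG, Finset.mul_sum, Finset.sum_mul]
      rw [Finset.sum_comm]
      refine Finset.sum_congr rfl fun A _ => Finset.sum_congr rfl fun C _ =>
        Finset.sum_congr rfl fun D _ => ?_
      ring
    rw [sprayP, this]
    field_simp
  rw [spray, e4, e5]
  ring

theorem IsFinslerMetric.berwaldCurvature_eq_zero (hF : IsFinslerMetric M F) (hM : IsOpen M)
    (hx : x ∈ M) {Γ : Fin m → Fin m → Fin m → ℝ} (hΓ : ∀ A B C, Γ A B C = Γ A C B)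
    (h : ∀ y, y ≠ 0 → ∀ B,
      pd B (fun w => F w y) x = ∑ A, pd A (F x) y * ∑ C, Γ A B C * y C)
    {y : Fin m → ℝ} (hy : y ≠ 0) (A B C D : Fin m) : berwaldCurvature F x y A B C D = 0 := by
  have hN : ∀ D (v : Fin m → ℝ), DifferentiableAt ℝ (fun v : Fin m → ℝ => ∑ C, Γ A D C * v C) v :=
    fun D v => DifferentiableAt.fun_sum fun C _ => (differentiableAt_coord C).const_mul _
  have hpN : ∀ B D (v : Fin m → ℝ),
      pd D (fun v : Fin m → ℝ => ∑ C, Γ A B C * v C) v = Γ A B D := by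
    intro B D v
    rw [pd_sum _ fun C _ => (differentiableAt_coord C).const_mul _]
    simp only [pd_const_mul _ (differentiableAt_coord _), pd_coord]
    simp [Matrix.one_apply]
  have h1 : ∀ v, v ≠ 0 → pd D (spray F x A) v = ∑ C, Γ A D C * v C := by
    intro v hv
    have e : spray F x A =ᶠ[nhds v] fun v => (1 / 2) * ∑ B, v B * ∑ C, Γ A B C * v C := by
      filter_upwards [isOpen_compl_singleton.mem_nhds hv] with w hw
      exact hF.spray_eq hM hx hΓ h hw A
    rw [pd_congr e, pd_const_mul _ (DifferentiableAt.fun_sum fun B _ =>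
        (differentiableAt_coord B).fun_mul (hN B v)),
      pd_sum _ fun B _ => (differentiableAt_coord B).fun_mul (hN B v)]
    simp only [pd_mul (differentiableAt_coord _) (hN _ v), hpN, pd_coord, Finset.sum_add_distrib]
    have i1 : ∑ B, (1 : Matrix (Fin m) (Fin m) ℝ) D B * ∑ C, Γ A B C * v C
        = ∑ C, Γ A D C * v C := by
      simp [Matrix.one_apply]
    have i2 : ∑ B, v B * Γ A B D = ∑ C, Γ A D C * v C :=
      Finset.sum_congr rfl fun B _ => by rw [hΓ A B D]; ring
    rw [i1, i2]
    ring
  have h2 : ∀ v, v ≠ 0 → pd C (pd D (spray F x A)) v = Γ A D C := by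
    intro v hv
    have e : pd D (spray F x A) =ᶠ[nhds v] fun v => ∑ C, Γ A D C * v C := by
      filter_upwards [isOpen_compl_singleton.mem_nhds hv] with w hw using h1 w hw
    rw [pd_congr e, hpN]
  have e : pd C (pd D (spray F x A)) =ᶠ[nhds y] fun _ => Γ A D C := by
    filter_upwards [isOpen_compl_singleton.mem_nhds hy] with w hw using h2 w hw
  rw [berwaldCurvature, pd_congr e, pd_const]

end Connection

/-! ### Cylindrical symmetry and the slice of the first two coordinates. -/

section Cylinder

theorem bar_add {n : ℕ} (x y : Fin (n + 1) → ℝ) : bar (x + y) = bar x + bar y := rfl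

theorem bar_smul {n : ℕ} (c : ℝ) (x : Fin (n + 1) → ℝ) : bar (c • x) = c • bar x := rfl

theorem bar_single_zero {n : ℕ} (a : ℝ) : bar (Pi.single (0 : Fin (n + 1)) a) = 0 := by
  ext j
  simp [bar, Fin.tail]

theorem bar_single_succ {n : ℕ} (j : Fin n) (a : ℝ) :
    bar (Pi.single j.succ a) = EuclideanSpace.single j a := by
  ext i
  simp [bar, Fin.tail, Pi.single_apply]

theorem bar_apply {n : ℕ} (x : Fin (n + 1) → ℝ) (j : Fin n) : bar x j = x j.succ := rfl

theorem continuous_bar {n : ℕ} : Continuous (bar : (Fin (n + 1) → ℝ) → _) :=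
  (PiLp.continuous_toLp 2 _).comp (continuous_pi fun j => continuous_apply j.succ)

theorem eq_of_bar_eq {n : ℕ} {x y : Fin (n + 1) → ℝ} (h0 : x 0 = y 0) (h : bar x = bar y) :
    x = y := by
  funext i
  refine Fin.cases h0 (fun j => ?_) i
  rw [← bar_apply x, h, bar_apply]

theorem isOpen_cyl {n : ℕ} {I : Set ℝ} (hI : IsOpen I) (ρ : ℝ) : IsOpen (cyl n I ρ) :=
  (hI.preimage (continuous_apply 0)).inter
    (isOpen_lt continuous_bar.norm continuous_const)

/-- The point `(a, b, 0, …, 0)`. -/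
noncomputable def slice {k : ℕ} (a b : ℝ) : Fin (k + 2) → ℝ :=
  a • Pi.single 0 (1 : ℝ) + b • Pi.single 1 (1 : ℝ)

variable {k : ℕ}

@[simp] theorem slice_apply_zero (a b : ℝ) : (slice a b : Fin (k + 2) → ℝ) 0 = a := by
  simp [slice]

@[simp] theorem slice_apply_one (a b : ℝ) : (slice a b : Fin (k + 2) → ℝ) 1 = b := by
  simp [slice]

@[simp] theorem slice_apply_succ_succ (a b : ℝ) (j : Fin k) :
    (slice a b : Fin (k + 2) → ℝ) j.succ.succ = 0 := by
  have : j.succ.succ ≠ (1 : Fin (k + 2)) := fun h =>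
    Fin.succ_ne_zero j (Fin.succ_injective _ h)
  simp [slice, this]

theorem smul_slice (c a b : ℝ) : c • (slice a b : Fin (k + 2) → ℝ) = slice (c * a) (c * b) := by
  simp [slice, smul_smul]

@[simp] theorem slice_zero_zero : (slice 0 0 : Fin (k + 2) → ℝ) = 0 := by
  simp [slice]

theorem bar_slice (a b : ℝ) :
    bar (slice a b : Fin (k + 2) → ℝ) = EuclideanSpace.single 0 b := by
  have h := bar_single_succ (0 : Fin (k + 1)) 1
  rw [Fin.succ_zero_eq_one] at h
  rw [slice, bar_add, bar_smul, bar_smul, bar_single_zero, h]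
  ext j
  simp

@[simp] theorem norm_bar_slice (a b : ℝ) : ‖bar (slice a b : Fin (k + 2) → ℝ)‖ = |b| := by
  rw [bar_slice]
  simp

theorem slice_ne_zero_iff {a b : ℝ} : (slice a b : Fin (k + 2) → ℝ) ≠ 0 ↔ a ≠ 0 ∨ b ≠ 0 := by
  constructor
  · intro h
    by_contra! h'
    exact h (by rw [h'.1, h'.2, slice_zero_zero])
  · rintro h h'
    have h0 := congrFun h' 0
    have h1 := congrFun h' 1
    simp only [slice_apply_zero, slice_apply_one, Pi.zero_apply] at h0 h1
    tauto

theorem slice_mem_cyl {I : Set ℝ} {ρ a b : ℝ} :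
    (slice a b : Fin (k + 2) → ℝ) ∈ cyl (k + 1) I ρ ↔ a ∈ I ∧ |b| < ρ := by
  simp [cyl]

theorem hasDerivAt_slice {a b : ℝ → ℝ} {a' b' s : ℝ} (ha : HasDerivAt a a' s)
    (hb : HasDerivAt b b' s) :
    HasDerivAt (fun s => (slice (a s) (b s) : Fin (k + 2) → ℝ)) (slice a' b') s :=
  (ha.smul_const _).add (hb.smul_const _)

theorem contDiff_slice : ContDiff ℝ ∞ fun p : ℝ × ℝ => (slice p.1 p.2 : Fin (k + 2) → ℝ) :=
  (contDiff_fst.smul contDiff_const).add (contDiff_snd.smul contDiff_const)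

theorem fderiv_slice (f : (Fin (k + 2) → ℝ) → ℝ) (y : Fin (k + 2) → ℝ) (a b : ℝ) :
    fderiv ℝ f y (slice a b) = a * pd 0 f y + b * pd 1 f y := by
  simp [slice, pd]

theorem hasDerivAt_even_zero {g : ℝ → ℝ} {d : ℝ} (hg : HasDerivAt g d 0)
    (heven : ∀ᶠ s in nhds 0, g (-s) = g s) : d = 0 := by
  have h1 : HasDerivAt (fun s => g (-s)) (-d) 0 := by
    have h2 : HasDerivAt g d (-0) := by simpa using hg
    simpa [Function.comp_def] using h2.comp (0 : ℝ) (hasDerivAt_neg (0 : ℝ))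
  have h2 := (h1.congr_of_eventuallyEq (f₁ := g) (by
    filter_upwards [heven] with s hs using hs.symm)).unique hg
  linarith

/-- `F(x, y) = |ȳ| φ(x⁰, |x̄|, y⁰ / |ȳ|)` on the cylinder. -/
def IsCylindrical {n : ℕ} (I : Set ℝ) (ρ : ℝ) (F : (Fin (n + 1) → ℝ) → (Fin (n + 1) → ℝ) → ℝ)
    (φ : ℝ → ℝ → ℝ → ℝ) : Prop :=
  ∀ x ∈ cyl n I ρ, ∀ y : Fin (n + 1) → ℝ, bar y ≠ 0 →
    F x y = ‖bar y‖ * φ (x 0) ‖bar x‖ (y 0 / ‖bar y‖)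

variable {n : ℕ} {I : Set ℝ} {ρ : ℝ} {F : (Fin (n + 1) → ℝ) → (Fin (n + 1) → ℝ) → ℝ}
    {φ : ℝ → ℝ → ℝ → ℝ}

theorem IsCylindrical.fiber_congr (hφ : IsCylindrical I ρ F φ) {x y y' : Fin (n + 1) → ℝ}
    (hx : x ∈ cyl n I ρ) (h0 : y 0 = y' 0) (h : ‖bar y‖ = ‖bar y'‖) : F x y = F x y' := by
  by_cases hy : bar y = 0
  · have hy' : bar y' = 0 := by rw [← norm_eq_zero, ← h, hy, norm_zero]
    rw [eq_of_bar_eq h0 (hy.trans hy'.symm)]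
  · have hy' : bar y' ≠ 0 := by rwa [← norm_ne_zero_iff, ← h, norm_ne_zero_iff]
    rw [hφ x hx y hy, hφ x hx y' hy', h0, h]

/-- Functions that agree at all vectors with nonzero `bar` part and are continuous off the zero
section agree off the zero section. -/
theorem eq_of_eq_of_bar_ne_zero (hn : 0 < n) {f g : (Fin (n + 1) → ℝ) → ℝ}
    (hf : ∀ y, y ≠ 0 → ContinuousAt f y) (hg : ∀ y, y ≠ 0 → ContinuousAt g y)
    (h : ∀ y, bar y ≠ 0 → f y = g y) {y : Fin (n + 1) → ℝ} (hy : y ≠ 0) : f y = g y := by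
  by_cases hb : bar y = 0
  -- Perturbing y in a radial direction makes its `bar` part nonzero; then pass to the limit.
  · set v : Fin (n + 1) → ℝ := Pi.single (Fin.succ ⟨0, hn⟩) 1 with hv
    have hc : ContinuousAt (fun s : ℝ => y + s • v) 0 := by fun_prop
    have hy0 : y + (0 : ℝ) • v = y := by simp
    have hfc : ContinuousAt (fun s : ℝ => f (y + s • v)) 0 :=
      ContinuousAt.comp (g := f) (by rw [hy0]; exact hf y hy) hc
    have hgc : ContinuousAt (fun s : ℝ => g (y + s • v)) 0 :=
      ContinuousAt.comp (g := g) (by rw [hy0]; exact hg y hy) hc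
    have hfg : (fun s : ℝ => f (y + s • v)) =ᶠ[nhdsWithin 0 {0}ᶜ] fun s => g (y + s • v) := by
      filter_upwards [self_mem_nhdsWithin] with s hs
      refine h _ ?_
      rw [bar_add, bar_smul, hb, zero_add, hv, bar_single_succ]
      exact smul_ne_zero hs (by simp)
    have h1 := (hfc.tendsto.mono_left nhdsWithin_le_nhds).congr' hfg
    have h2 := tendsto_nhds_unique h1 (hgc.tendsto.mono_left nhdsWithin_le_nhds)
    simpa using h2
  · exact h y hb

/-- The formula with φ says nothing about axial vectors; these are reached by continuity of F. -/
theorem IsCylindrical.base_congr (hφ : IsCylindrical I ρ F φ) (hF : IsFinslerMetric (cyl n I ρ) F)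
    (hI : IsOpen I) (hn : 0 < n) {x x' : Fin (n + 1) → ℝ} (hx : x ∈ cyl n I ρ)
    (h0 : x 0 = x' 0) (h : ‖bar x‖ = ‖bar x'‖) (y : Fin (n + 1) → ℝ) : F x y = F x' y := by
  have hx' : x' ∈ cyl n I ρ := ⟨h0 ▸ hx.1, by rw [← h]; exact hx.2⟩
  by_cases hy : y = 0
  · rw [hy, hF.apply_zero hx, hF.apply_zero hx']
  · refine eq_of_eq_of_bar_ne_zero hn
      (fun v hv => (hF.contDiffAt_fiber (isOpen_cyl hI ρ) hx hv).continuousAt)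
      (fun v hv => (hF.contDiffAt_fiber (isOpen_cyl hI ρ) hx' hv).continuousAt) ?_ hy
    intro v hv
    rw [hφ x hx v hv, hφ x' hx' v hv, h0, h]

theorem norm_bar_add_eq_norm_bar_sub {y : Fin (n + 1) → ℝ} {A : Fin (n + 1)} (hA : A ≠ 0)
    (h : y A = 0) (s : ℝ) :
    ‖bar (y + (-s) • Pi.single A (1 : ℝ))‖ = ‖bar (y + s • Pi.single A (1 : ℝ))‖ := by
  obtain ⟨j, rfl⟩ := Fin.exists_succ_eq.mpr hA
  simp only [EuclideanSpace.norm_eq]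
  congr 1
  refine Finset.sum_congr rfl fun i _ => ?_
  simp only [bar_apply, Pi.add_apply, Pi.smul_apply, Pi.single_apply]
  by_cases hij : i = j
  · simp [hij, h]
  · simp [hij]

theorem add_smul_single_apply_zero {y : Fin (n + 1) → ℝ} {A : Fin (n + 1)} (hA : A ≠ 0) (s : ℝ) :
    (y + s • (Pi.single A 1 : Fin (n + 1) → ℝ)) 0 = y 0 := by
  simp [hA.symm]

/-- The reflection of the coordinate y^A preserves F and fixes y, so F is even along this direction.
-/
theorem IsCylindrical.pd_fiber_eq_zero (hφ : IsCylindrical I ρ F φ)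
    (hF : IsFinslerMetric (cyl n I ρ) F) (hI : IsOpen I) {x y : Fin (n + 1) → ℝ}
    (hx : x ∈ cyl n I ρ) (hy : y ≠ 0) {A : Fin (n + 1)} (hA : A ≠ 0) (h : y A = 0) :
    pd A (F x) y = 0 := by
  refine hasDerivAt_even_zero (hasDerivAt_pd ((hF.contDiffAt_fiber (isOpen_cyl hI ρ)
    hx hy).differentiableAt (by simp)) A) (Filter.Eventually.of_forall
      fun s => hφ.fiber_congr hx ?_ ?_)
  · rw [add_smul_single_apply_zero hA, add_smul_single_apply_zero hA]
  · exact norm_bar_add_eq_norm_bar_sub hA h s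

theorem IsFinslerMetric.hasDerivAt_comp {m : ℕ} {M : Set (Fin m → ℝ)}
    {F : (Fin m → ℝ) → (Fin m → ℝ) → ℝ} (hF : IsFinslerMetric M F) (hM : IsOpen M)
    {X Y : ℝ → Fin m → ℝ} {v w : Fin m → ℝ} {t : ℝ} (hX : HasDerivAt X v t)
    (hY : HasDerivAt Y w t) (hx : X t ∈ M) (hy : Y t ≠ 0) :
    HasDerivAt (fun t => F (X t) (Y t))
      (fderiv ℝ (fun x => F x (Y t)) (X t) v + fderiv ℝ (F (X t)) (Y t) w) t := by
  have h := ((hF.contDiffAt hM hx hy).differentiableAt (by simp)).hasFDerivAt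
  have h1 : fderiv ℝ (fun x => F x (Y t)) (X t) v
      = fderiv ℝ (fun p : (Fin m → ℝ) × (Fin m → ℝ) => F p.1 p.2) (X t, Y t) (v, 0) := by
    have := (h.comp (X t) ((hasFDerivAt_id (𝕜 := ℝ) (X t)).prodMk
      (hasFDerivAt_const (𝕜 := ℝ) (Y t) (X t)))).fderiv
    exact congrArg (fun L => L v) this
  have h2 : fderiv ℝ (F (X t)) (Y t) w
      = fderiv ℝ (fun p : (Fin m → ℝ) × (Fin m → ℝ) => F p.1 p.2) (X t, Y t) (0, w) := by
    have := (h.comp (Y t) ((hasFDerivAt_const (𝕜 := ℝ) (X t) (Y t)).prodMk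
      (hasFDerivAt_id (𝕜 := ℝ) (Y t)))).fderiv
    exact congrArg (fun L => L w) this
  have h3 := h.comp_hasDerivAt t (hX.prodMk hY)
  rw [h1, h2, ← map_add, Prod.mk_add_mk, add_zero, zero_add]
  exact h3

end Cylinder

/-! ### The dichotomy at one point: Euclidean plane or diagonal connection. -/

section Planar

/-- An even planar norm with linearly dependent functions `g_a(a, 1)` and `a g_b(a, 1)` is
Euclidean. -/
theorem sq_eq_of_dependent {g : ℝ → ℝ → ℝ} {d₀ d₁ : ℝ → ℝ} {c₁ c₂ : ℝ}
    (hcont : ∀ a b, a ≠ 0 ∨ b ≠ 0 → ContinuousAt (fun p : ℝ × ℝ => g p.1 p.2) (a, b))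
    (hom : ∀ a b c, 0 < c → g (c * a) (c * b) = c * g a b)
    (heven : ∀ a b, g a (-b) = g a b) (hpos : ∀ a b, a ≠ 0 ∨ b ≠ 0 → 0 < g a b)
    (hderiv : ∀ a, HasDerivAt (fun a => g a 1) (d₀ a) a) (hd₀ : Continuous d₀)
    (heuler : ∀ a, a * d₀ a + d₁ a = g a 1) (hc : c₁ ≠ 0 ∨ c₂ ≠ 0)
    (hdep : ∀ a, c₁ * d₀ a + c₂ * (a * d₁ a) = 0) (a b : ℝ) :
    g a b ^ 2 = a ^ 2 * g 1 0 ^ 2 + b ^ 2 * g 0 1 ^ 2 := by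
  have hw : ∀ a, 0 < g a 1 := fun a => hpos a 1 (Or.inr one_ne_zero)
  have hwc : Continuous fun a => g a 1 :=
    continuous_iff_continuousAt.mpr fun a => (hderiv a).continuousAt
  -- If c₁ = 0, then d₁ vanishes off 0, hence at 0 by continuity, against d₁(0) = g(0, 1) > 0.
  have hc₁ : c₁ ≠ 0 := by
    intro h0
    have hc₂ : c₂ ≠ 0 := hc.resolve_left fun h => h h0
    have h1 : EqOn d₁ (fun _ => 0) {0}ᶜ := by
      intro a ha
      have := hdep a
      rw [h0, zero_mul, zero_add] at this
      exact ((mul_eq_zero.mp ((mul_eq_zero.mp this).resolve_left hc₂)).resolve_left ha)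
    have h2 : Continuous d₁ := by
      have : d₁ = fun a => g a 1 - a * d₀ a := funext fun a => by rw [← heuler a]; ring
      rw [this]
      fun_prop
    have h3 := h2.ext_on (dense_compl_singleton 0) continuous_const h1
    have h4 := heuler 0
    rw [h3] at h4
    have := hw 0
    simp only [zero_mul, zero_add] at h4
    linarith
  set κ := c₂ / c₁ with hκ
  -- Eliminating d₁ by Euler's identity gives a linear ODE for w(a) = g(a, 1), with first integral
  -- w²/(1 - κ a²).
  have hode : ∀ a, (1 - κ * a ^ 2) * d₀ a = -(κ * a * g a 1) := by
    intro a
    have h1 : d₁ a = g a 1 - a * d₀ a := by rw [← heuler a]; ring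
    have h2 := hdep a
    rw [h1] at h2
    have h3 : c₂ = κ * c₁ := by rw [hκ]; field_simp
    rw [h3] at h2
    have h4 : c₁ * (d₀ a + κ * (a * (g a 1 - a * d₀ a))) = 0 := by linear_combination h2
    have h5 := (mul_eq_zero.mp h4).resolve_left hc₁
    linear_combination h5
  -- At a zero of the leading coefficient the ODE would give κ a w = 0, hence κ a = 0 and 1 = 0.
  have hne : ∀ a, 1 - κ * a ^ 2 ≠ 0 := by
    intro a h
    have h1 := hode a
    rw [h, zero_mul, eq_comm, neg_eq_zero] at h1
    have h2 := (mul_eq_zero.mp h1).resolve_right (hw a).ne'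
    have : κ * a ^ 2 = 0 := by rw [pow_two, ← mul_assoc, h2, zero_mul]
    rw [this] at h
    norm_num at h
  have hconst : ∀ a, g a 1 ^ 2 / (1 - κ * a ^ 2) = g 0 1 ^ 2 := by
    intro a
    have h1 : ∀ a, HasDerivAt (fun a => g a 1 ^ 2 / (1 - κ * a ^ 2)) 0 a := by
      intro a
      have h2 : HasDerivAt (fun a : ℝ => 1 - κ * a ^ 2) (-(κ * (2 * a))) a := by
        simpa using ((hasDerivAt_pow 2 a).const_mul κ).const_sub 1
      have h3 := ((hderiv a).pow 2).div h2 (hne a)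
      refine h3.congr_deriv ?_
      rw [div_eq_zero_iff]
      left
      simp only [Nat.cast_ofNat, Nat.add_one_sub_one, pow_one, Pi.pow_apply]
      linear_combination (2 * g a 1) * hode a
    have h4 := is_const_of_deriv_eq_zero (fun a => (h1 a).differentiableAt)
      (fun a => (h1 a).deriv) a 0
    simpa using h4
  have hsq : ∀ a b, 0 < b → g a b ^ 2 = g 0 1 ^ 2 * (b ^ 2 - κ * a ^ 2) := by
    intro a b hb
    have h1 := hom (a / b) 1 b hb
    rw [mul_div_cancel₀ _ hb.ne', mul_one] at h1
    have h2 := (div_eq_iff (hne (a / b))).mp (hconst (a / b))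
    rw [h1, mul_pow, h2]
    field_simp
  have hsq0 : ∀ a, a ≠ 0 → g a 0 ^ 2 = g 0 1 ^ 2 * (0 ^ 2 - κ * a ^ 2) := by
    intro a ha
    have h1 : ContinuousAt (fun b => g a b ^ 2) 0 :=
      ((hcont a 0 (Or.inl ha)).comp (f := fun b : ℝ => (a, b)) (by fun_prop)).pow 2
    have h2 : ContinuousAt (fun b : ℝ => g 0 1 ^ 2 * (b ^ 2 - κ * a ^ 2)) 0 := by fun_prop
    refine tendsto_nhds_unique (h1.tendsto.mono_left
      (nhdsWithin_le_nhds (s := Ioi 0))) ?_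
    refine (h2.tendsto.mono_left nhdsWithin_le_nhds).congr' ?_
    filter_upwards [self_mem_nhdsWithin] with b hb using (hsq a b hb).symm
  -- Continuity up to b = 0 identifies the remaining constant κ with the axial length.
  have h10 : g 1 0 ^ 2 = -(κ * g 0 1 ^ 2) := by
    rw [hsq0 1 one_ne_zero]; ring
  rw [h10]
  rcases lt_trichotomy b 0 with hb | hb | hb
  · rw [← heven, hsq a (-b) (neg_pos.mpr hb)]
    ring
  · subst hb
    by_cases ha : a = 0
    · subst ha
      have := hom 0 0 2 two_pos
      rw [mul_zero] at this
      have : g 0 0 = 0 := by linarith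
      rw [this]
      ring
    · rw [hsq0 a ha]
      ring
  · rw [hsq a b hb]
    ring

variable {k : ℕ} {I : Set ℝ} {ρ : ℝ} {F : (Fin (k + 2) → ℝ) → (Fin (k + 2) → ℝ) → ℝ}
    {φ : ℝ → ℝ → ℝ → ℝ}

theorem hasDerivAt_fiber_slice {m : ℕ} {M : Set (Fin (m + 2) → ℝ)}
    {F : (Fin (m + 2) → ℝ) → (Fin (m + 2) → ℝ) → ℝ} {x : Fin (m + 2) → ℝ}
    (hF : IsFinslerMetric M F) (hM : IsOpen M)
    (hx : x ∈ M) {α β : ℝ → ℝ} {α' β' s : ℝ} (ha : HasDerivAt α α' s)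
    (hb : HasDerivAt β β' s) (h : α s ≠ 0 ∨ β s ≠ 0) :
    HasDerivAt (fun s => F x (slice (α s) (β s)))
      (α' * pd 0 (F x) (slice (α s) (β s)) + β' * pd 1 (F x) (slice (α s) (β s))) s := by
  rw [← fderiv_slice]
  exact (((hF.contDiffAt_fiber hM hx (slice_ne_zero_iff.mpr h)).differentiableAt
    (by simp)).hasFDerivAt).comp_hasDerivAt s (hasDerivAt_slice ha hb)

theorem IsFinslerMetric.euler_slice {m : ℕ} {M : Set (Fin (m + 2) → ℝ)}
    {F : (Fin (m + 2) → ℝ) → (Fin (m + 2) → ℝ) → ℝ} {x : Fin (m + 2) → ℝ}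
    (hF : IsFinslerMetric M F) (hM : IsOpen M) (hx : x ∈ M) {a b : ℝ} (h : a ≠ 0 ∨ b ≠ 0) :
    a * pd 0 (F x) (slice a b) + b * pd 1 (F x) (slice a b) = F x (slice a b) := by
  rw [← hF.euler hM hx (slice_ne_zero_iff.mpr h), Fin.sum_univ_succ, Fin.sum_univ_succ]
  simp

/-- The restriction of `F` to the plane of the first two coordinates is Euclidean, with
orthogonal axes. -/
def IsEuclideanAt (F : (Fin (k + 2) → ℝ) → (Fin (k + 2) → ℝ) → ℝ) (x : Fin (k + 2) → ℝ) : Prop :=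
  ∀ a b, F x (slice a b) ^ 2 = a ^ 2 * F x (slice 1 0) ^ 2 + b ^ 2 * F x (slice 0 1) ^ 2

theorem IsCylindrical.apply_slice_neg (hφ : IsCylindrical I ρ F φ) {x : Fin (k + 2) → ℝ}
    (hx : x ∈ cyl (k + 1) I ρ) (a b : ℝ) : F x (slice a (-b)) = F x (slice a b) :=
  hφ.fiber_congr hx (by simp) (by simp)

theorem IsCylindrical.pd_zero_slice_neg (hφ : IsCylindrical I ρ F φ)
    (hF : IsFinslerMetric (cyl (k + 1) I ρ) F) (hI : IsOpen I) {x : Fin (k + 2) → ℝ}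
    (hx : x ∈ cyl (k + 1) I ρ) {a b : ℝ} (h : a ≠ 0 ∨ b ≠ 0) :
    pd 0 (F x) (slice a (-b)) = pd 0 (F x) (slice a b) := by
  have h1 := hasDerivAt_fiber_slice hF (isOpen_cyl hI ρ) hx (hasDerivAt_id a)
    (hasDerivAt_const a b) h
  have h2 := hasDerivAt_fiber_slice hF (isOpen_cyl hI ρ) hx (hasDerivAt_id a)
    (hasDerivAt_const a (-b)) (h.imp id neg_ne_zero.mpr)
  simp only [hφ.apply_slice_neg hx, id] at h1 h2
  simpa using h2.unique h1

theorem IsCylindrical.pd_one_slice_neg (hφ : IsCylindrical I ρ F φ)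
    (hF : IsFinslerMetric (cyl (k + 1) I ρ) F) (hI : IsOpen I) {x : Fin (k + 2) → ℝ}
    (hx : x ∈ cyl (k + 1) I ρ) {a b : ℝ} (h : a ≠ 0 ∨ b ≠ 0) :
    pd 1 (F x) (slice a (-b)) = -pd 1 (F x) (slice a b) := by
  have h1 := hasDerivAt_fiber_slice hF (isOpen_cyl hI ρ) hx (hasDerivAt_const b a)
    (hasDerivAt_id b) h
  have h2 := hasDerivAt_fiber_slice hF (isOpen_cyl hI ρ) hx (hasDerivAt_const b a)
    (hasDerivAt_neg b) (h.imp id neg_ne_zero.mpr)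
  simp only [hφ.apply_slice_neg hx, id] at h1 h2
  have := h2.unique h1
  linarith

theorem IsCylindrical.pd_base_slice_neg (hφ : IsCylindrical I ρ F φ) (hI : IsOpen I)
    {x : Fin (k + 2) → ℝ} (hx : x ∈ cyl (k + 1) I ρ) (a b : ℝ) (B : Fin (k + 2)) :
    pd B (fun w => F w (slice a (-b))) x = pd B (fun w => F w (slice a b)) x := by
  refine pd_congr ?_ B
  filter_upwards [(isOpen_cyl hI ρ).mem_nhds hx] with w hw using hφ.apply_slice_neg hw a b

/-- At a point of the slice where the Berwald curvature vanishes, either `F` is Euclidean or its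
base derivatives come from a diagonal connection. -/
theorem IsCylindrical.isEuclideanAt_or (hφ : IsCylindrical I ρ F φ)
    (hF : IsFinslerMetric (cyl (k + 1) I ρ) F) (hI : IsOpen I) {x : Fin (k + 2) → ℝ}
    (hx : x ∈ cyl (k + 1) I ρ)
    (hB : ∀ y, y ≠ 0 → ∀ A B C D, berwaldCurvature F x y A B C D = 0) :
    IsEuclideanAt F x ∨ ∃ α δ : ℝ, ∀ a b, a ≠ 0 ∨ b ≠ 0 →
      pd 0 (fun w => F w (slice a b)) x = α * a * pd 0 (F x) (slice a b) ∧
      pd 1 (fun w => F w (slice a b)) x = δ * b * pd 1 (F x) (slice a b) := by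
  have hM := isOpen_cyl (n := k + 1) hI ρ
  obtain ⟨Γ, hΓ, h⟩ := hF.exists_connection hM hx (by omega) hB
  have hred : ∀ a b, a ≠ 0 ∨ b ≠ 0 → ∀ B, pd B (fun w => F w (slice a b)) x
      = (Γ 0 B 0 * a + Γ 0 B 1 * b) * pd 0 (F x) (slice a b)
        + (Γ 1 B 0 * a + Γ 1 B 1 * b) * pd 1 (F x) (slice a b) := by
    intro a b hab B
    have hy := slice_ne_zero_iff (k := k).mpr hab
    -- The remaining n - 1 directions do not contribute, because F is even in each of them.
    have h0 : ∀ j : Fin k, pd j.succ.succ (F x) (slice a b) = 0 := fun j =>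
      hφ.pd_fiber_eq_zero hF hI hx hy (Fin.succ_ne_zero _) (by simp)
    rw [h _ hy B]
    simp only [Fin.sum_univ_succ, h0, slice_apply_succ_succ, Fin.succ_zero_eq_one,
      slice_apply_zero, slice_apply_one, mul_zero, zero_mul, Finset.sum_const_zero, add_zero]
    ring
  -- Under b ↦ -b the base derivatives and F_{y^0} are even and F_{y^1} is odd; this is the odd part
  -- of `hred`.
  have hodd : ∀ a b, a ≠ 0 ∨ b ≠ 0 → ∀ B,
      Γ 0 B 1 * b * pd 0 (F x) (slice a b) + Γ 1 B 0 * a * pd 1 (F x) (slice a b) = 0 := by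
    intro a b hab B
    have h1 := hred a (-b) (hab.imp id neg_ne_zero.mpr) B
    rw [hφ.pd_base_slice_neg hI hx, hφ.pd_zero_slice_neg hF hI hx hab,
      hφ.pd_one_slice_neg hF hI hx hab, hred a b hab B] at h1
    linarith
  by_cases hz : (Γ 0 0 1 = 0 ∧ Γ 1 0 0 = 0) ∧ Γ 0 1 1 = 0 ∧ Γ 1 1 0 = 0
  · obtain ⟨⟨h1, h2⟩, h3, h4⟩ := hz
    refine Or.inr ⟨Γ 0 0 0, Γ 1 1 1, fun a b hab => ⟨?_, ?_⟩⟩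
    · rw [hred a b hab, h1, h2, hΓ 1 0 1, h4]
      ring
    · rw [hred a b hab, hΓ 0 1 0, h1, h3, h4]
      ring
  · left
    obtain ⟨c₁, c₂, hc, hdep⟩ : ∃ c₁ c₂ : ℝ, (c₁ ≠ 0 ∨ c₂ ≠ 0) ∧ ∀ a,
        c₁ * pd 0 (F x) (slice a 1) + c₂ * (a * pd 1 (F x) (slice a 1)) = 0 := by
      rcases not_and_or.mp hz with h' | h'
      · refine ⟨_, _, not_and_or.mp h', fun a => ?_⟩
        have := hodd a 1 (Or.inr one_ne_zero) 0
        linarith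
      · refine ⟨_, _, not_and_or.mp h', fun a => ?_⟩
        have := hodd a 1 (Or.inr one_ne_zero) 1
        linarith
    have hsm : ∀ a b : ℝ, a ≠ 0 ∨ b ≠ 0 →
        ContinuousAt (fun p : ℝ × ℝ => (slice p.1 p.2 : Fin (k + 2) → ℝ)) (a, b) := fun a b _ =>
      contDiff_slice.continuous.continuousAt
    refine sq_eq_of_dependent (g := fun a b => F x (slice a b))
      (d₀ := fun a => pd 0 (F x) (slice a 1)) (d₁ := fun a => pd 1 (F x) (slice a 1))
      ?_ ?_ (hφ.apply_slice_neg hx) ?_ ?_ ?_ ?_ hc hdep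
    · intro a b hab
      exact ContinuousAt.comp (g := F x) (hF.contDiffAt_fiber hM hx
        (slice_ne_zero_iff.mpr hab)).continuousAt (hsm a b hab)
    · intro a b c hc
      rw [← smul_slice, hF.homogeneous x hx _ c hc]
    · intro a b hab
      exact hF.pos hM hx (slice_ne_zero_iff.mpr hab)
    · intro a
      simpa using hasDerivAt_fiber_slice hF hM hx (hasDerivAt_id a) (hasDerivAt_const a 1)
        (Or.inr one_ne_zero)
    · refine continuous_iff_continuousAt.mpr fun a => ?_
      exact ContinuousAt.comp (g := pd 0 (F x)) (contDiffAt_pd (hF.contDiffAt_fiber hM hx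
        (slice_ne_zero_iff.mpr (Or.inr one_ne_zero))) 0).continuousAt
        ((hsm a 1 (Or.inr one_ne_zero)).comp (f := fun a : ℝ => (a, (1 : ℝ))) (by fun_prop))
    · intro a
      simpa using hF.euler_slice hM hx (a := a) (b := 1) (Or.inr one_ne_zero)

end Planar

/-! ### Propagation of the Euclidean property over the cylinder. -/

section Rigidity

variable {k : ℕ} {I : Set ℝ} {ρ : ℝ} {F : (Fin (k + 2) → ℝ) → (Fin (k + 2) → ℝ) → ℝ}
    {φ : ℝ → ℝ → ℝ → ℝ}

/-- `F` at the vector whose axial and radial parts have `F`-norms `|a|` and `|b|`. -/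
noncomputable def normalized (F : (Fin (k + 2) → ℝ) → (Fin (k + 2) → ℝ) → ℝ) (a b : ℝ)
    (x : Fin (k + 2) → ℝ) : ℝ :=
  F x (slice (a / F x (slice 1 0)) (b / F x (slice 0 1)))

/-- After rescaling the axes, the condition compares F² with a² + b², which does not depend on x. -/
theorem isEuclideanAt_iff {M : Set (Fin (k + 2) → ℝ)} (hF : IsFinslerMetric M F) (hM : IsOpen M)
    {x : Fin (k + 2) → ℝ} (hx : x ∈ M) :
    IsEuclideanAt F x ↔ ∀ a b, a ≠ 0 ∨ b ≠ 0 → normalized F a b x ^ 2 - (a ^ 2 + b ^ 2) = 0 := by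
  have hp := hF.pos hM hx (slice_ne_zero_iff.mpr (Or.inl one_ne_zero) :
    (slice 1 0 : Fin (k + 2) → ℝ) ≠ 0)
  have hq := hF.pos hM hx (slice_ne_zero_iff.mpr (Or.inr one_ne_zero) :
    (slice 0 1 : Fin (k + 2) → ℝ) ≠ 0)
  constructor
  · intro h a b _
    rw [normalized, h]
    field_simp
    ring
  · intro h a b
    by_cases hab : a ≠ 0 ∨ b ≠ 0
    · have := h (a * F x (slice 1 0)) (b * F x (slice 0 1))
        (hab.imp (mul_ne_zero · hp.ne') (mul_ne_zero · hq.ne'))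
      rw [normalized, mul_div_cancel_right₀ _ hp.ne', mul_div_cancel_right₀ _ hq.ne'] at this
      linarith
    · push Not at hab
      rw [hab.1, hab.2, slice_zero_zero, hF.apply_zero hx]
      ring

/-- The outer square is what treats both alternatives at once. At a Euclidean point its base is
zero, so the chain rule gives zero. At a diagonal point the connection only rescales the two axes,
and dividing by the axial lengths cancels this effect. No openness argument is then needed for
propagation. -/
theorem IsCylindrical.hasDerivAt_normalized (hφ : IsCylindrical I ρ F φ)
    (hF : IsFinslerMetric (cyl (k + 1) I ρ) F) (hI : IsOpen I)
    (hB : IsBerwald (cyl (k + 1) I ρ) F) {X : ℝ → Fin (k + 2) → ℝ} {v₀ v₁ τ : ℝ}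
    (hX : HasDerivAt X (slice v₀ v₁) τ) (hx : X τ ∈ cyl (k + 1) I ρ) {a b : ℝ}
    (hab : a ≠ 0 ∨ b ≠ 0) :
    HasDerivAt (fun τ => (normalized F a b (X τ) ^ 2 - (a ^ 2 + b ^ 2)) ^ 2) 0 τ := by
  have hM := isOpen_cyl (n := k + 1) hI ρ
  have h10 : (1 : ℝ) ≠ 0 ∨ (0 : ℝ) ≠ 0 := Or.inl one_ne_zero
  have h01 : (0 : ℝ) ≠ 0 ∨ (1 : ℝ) ≠ 0 := Or.inr one_ne_zero
  have hp := hF.pos hM hx (slice_ne_zero_iff.mpr h10 : (slice 1 0 : Fin (k + 2) → ℝ) ≠ 0)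
  have hq := hF.pos hM hx (slice_ne_zero_iff.mpr h01 : (slice 0 1 : Fin (k + 2) → ℝ) ≠ 0)
  have hdp := hF.hasDerivAt_comp hM hX (hasDerivAt_const τ (slice 1 0)) hx
    (slice_ne_zero_iff.mpr h10)
  have hdq := hF.hasDerivAt_comp hM hX (hasDerivAt_const τ (slice 0 1)) hx
    (slice_ne_zero_iff.mpr h01)
  have hab' : a / F (X τ) (slice 1 0) ≠ 0 ∨ b / F (X τ) (slice 0 1) ≠ 0 :=
    hab.imp (div_ne_zero · hp.ne') (div_ne_zero · hq.ne')
  have hh := hF.hasDerivAt_comp hM hX (hasDerivAt_slice ((hasDerivAt_const τ a).div hdp hp.ne')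
    ((hasDerivAt_const τ b).div hdq hq.ne')) hx (slice_ne_zero_iff.mpr hab')
  have hK := ((hh.pow 2).sub_const (a ^ 2 + b ^ 2)).pow 2
  refine hK.congr_deriv ?_
  rcases hφ.isEuclideanAt_or hF hI hx (hB _ hx) with hE | ⟨α, δ, h⟩
  · have h0 := (isEuclideanAt_iff hF hM hx).mp hE a b hab
    rw [normalized] at h0
    simp only [Pi.pow_apply, Pi.div_apply, h0]
    simp
  · have e1 := hF.euler_slice hM hx h10
    have e2 := hF.euler_slice hM hx h01
    simp only [fderiv_slice, map_zero, add_zero, zero_mul, one_mul, zero_add, zero_sub,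
      Pi.div_apply] at e1 e2 ⊢
    simp only [(h _ _ h10).1, (h _ _ h10).2, (h _ _ h01).1, (h _ _ h01).2, (h _ _ hab').1,
      (h _ _ hab').2, e1, e2]
    field_simp
    ring

/-- If a cylindrically symmetric Berwald metric is Euclidean at one point of the slice, then it is
Euclidean at all points of the slice. -/
theorem IsCylindrical.isEuclideanAt_of_isEuclideanAt (hφ : IsCylindrical I ρ F φ)
    (hF : IsFinslerMetric (cyl (k + 1) I ρ) F) (hI : IsOpen I) (hIc : I.OrdConnected)
    (hB : IsBerwald (cyl (k + 1) I ρ) F) {t₀ s₀ t₁ s₁ : ℝ}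
    (h₀ : (slice t₀ s₀ : Fin (k + 2) → ℝ) ∈ cyl (k + 1) I ρ)
    (h₁ : (slice t₁ s₁ : Fin (k + 2) → ℝ) ∈ cyl (k + 1) I ρ)
    (hE : IsEuclideanAt F (slice t₀ s₀)) : IsEuclideanAt F (slice t₁ s₁) := by
  have hM := isOpen_cyl (n := k + 1) hI ρ
  rw [slice_mem_cyl] at h₀ h₁
  -- The segment between the two points stays in the cylinder, since I × (-ρ, ρ) is convex.
  set X : ℝ → Fin (k + 2) → ℝ := fun τ => slice (t₀ + τ * (t₁ - t₀)) (s₀ + τ * (s₁ - s₀)) with hX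
  have hXd : ∀ τ, HasDerivAt X (slice (t₁ - t₀) (s₁ - s₀)) τ := by
    intro τ
    refine hasDerivAt_slice ?_ ?_
    · simpa using ((hasDerivAt_id τ).mul_const (t₁ - t₀)).const_add t₀
    · simpa using ((hasDerivAt_id τ).mul_const (s₁ - s₀)).const_add s₀
  have hXm : ∀ τ ∈ Icc (0 : ℝ) 1, X τ ∈ cyl (k + 1) I ρ := by
    intro τ hτ
    refine slice_mem_cyl.mpr ⟨?_, ?_⟩
    · simpa using hIc.convex.add_smul_sub_mem h₀.1 h₁.1 hτ
    · have h2 := (convex_Ioo (-ρ) ρ).add_smul_sub_mem (abs_lt.mp h₀.2) (abs_lt.mp h₁.2) hτ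
      exact abs_lt.mpr (by simpa using h2)
  have hX0 : X 0 = slice t₀ s₀ := by simp [hX]
  have hX1 : X 1 = slice t₁ s₁ := by simp [hX]
  rw [← hX1, isEuclideanAt_iff hF hM (hXm 1 (by simp))]
  intro a b hab
  have hd := fun τ hτ => hφ.hasDerivAt_normalized hF hI hB (hXd τ) (hXm τ hτ) hab
  have hc := constant_of_has_deriv_right_zero
    (fun τ hτ => (hd τ hτ).continuousAt.continuousWithinAt)
    (fun τ hτ => (hd τ (Ico_subset_Icc_self hτ)).hasDerivWithinAt) 1 (by simp)
  rw [hX0, (isEuclideanAt_iff hF hM (slice_mem_cyl.mpr h₀)).mp hE a b hab] at hc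
  simpa using hc

/-- Symmetry moves any pair (x, y) to the slice, so F² = F(x, e₀)² (y⁰)² + F(x, e₁)² |ȳ|². This is a
diagonal Riemannian metric, smooth because F(·, e₀) and F(·, e₁) are, and β = 0. -/
theorem IsCylindrical.isRanders_of_isEuclideanAt (hφ : IsCylindrical I ρ F φ)
    (hF : IsFinslerMetric (cyl (k + 1) I ρ) F) (hI : IsOpen I)
    (hE : ∀ t s, (slice t s : Fin (k + 2) → ℝ) ∈ cyl (k + 1) I ρ → IsEuclideanAt F (slice t s)) :
    IsRanders (cyl (k + 1) I ρ) F := by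
  have hM := isOpen_cyl (n := k + 1) hI ρ
  have h10 : (slice 1 0 : Fin (k + 2) → ℝ) ≠ 0 := slice_ne_zero_iff.mpr (Or.inl one_ne_zero)
  have h01 : (slice 0 1 : Fin (k + 2) → ℝ) ≠ 0 := slice_ne_zero_iff.mpr (Or.inr one_ne_zero)
  set d : (Fin (k + 2) → ℝ) → Fin (k + 2) → ℝ := fun x =>
    Fin.cons (F x (slice 1 0) ^ 2) fun _ => F x (slice 0 1) ^ 2 with hd
  have hquad : ∀ x ∈ cyl (k + 1) I ρ, ∀ y,
      F x y = √(y ⬝ᵥ (Matrix.diagonal (d x) *ᵥ y)) := by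
    intro x hx y
    have hx' : (slice (x 0) ‖bar x‖ : Fin (k + 2) → ℝ) ∈ cyl (k + 1) I ρ :=
      slice_mem_cyl.mpr ⟨hx.1, by rw [abs_norm]; exact hx.2⟩
    have hbase := hφ.base_congr hF hI (Nat.succ_pos k) hx (x' := slice (x 0) ‖bar x‖)
      (by simp) (by simp)
    have hy : F x y = F (slice (x 0) ‖bar x‖) (slice (y 0) ‖bar y‖) := by
      rw [← hbase]
      exact hφ.fiber_congr hx (by simp) (by simp)
    have hsq : F x y ^ 2 = y ⬝ᵥ (Matrix.diagonal (d x) *ᵥ y) := by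
      rw [hy, hE _ _ hx' (y 0) ‖bar y‖, ← hbase, ← hbase, EuclideanSpace.real_norm_sq_eq,
        dotProduct, Finset.sum_mul]
      conv_rhs => rw [Fin.sum_univ_succ]
      simp only [Matrix.mulVec_diagonal, hd, Fin.cons_zero, Fin.cons_succ, bar_apply]
      congr 1
      · ring
      · exact Finset.sum_congr rfl fun j _ => by ring
    rw [← hsq, Real.sqrt_sq (hF.nonneg x hx y)]
  refine ⟨fun x => Matrix.diagonal (d x), fun _ => 0, fun A B => ?_, fun A => contDiffOn_const,
    fun x hx => ?_, fun x hx y hy => ?_, fun x hx y => ?_⟩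
  · intro x hx
    refine ContDiffAt.contDiffWithinAt ?_
    by_cases hAB : A = B
    · subst hAB
      simp only [Matrix.diagonal_apply_eq]
      refine Fin.cases ?_ (fun j => ?_) A
      · exact (hF.contDiffAt_base hM hx h10).pow 2
      · exact (hF.contDiffAt_base hM hx h01).pow 2
    · simp only [Matrix.diagonal_apply_ne _ hAB]
      exact contDiffAt_const
  · refine Matrix.PosDef.diagonal fun A => ?_
    refine Fin.cases ?_ (fun j => ?_) A
    · exact pow_pos (hF.pos hM hx h10) 2
    · exact pow_pos (hF.pos hM hx h01) 2
  · rw [← hquad x hx y, zero_dotProduct, abs_zero]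
    exact hF.pos hM hx hy
  · rw [← hquad x hx y, zero_dotProduct, add_zero]

end Rigidity

/-! ### From diagonal connections to the equations for φ, with regularity at r = 0. -/

section Equations

theorem differentiableAt_fun_div {E : Type*} [NormedAddCommGroup E] [NormedSpace ℝ E]
    {f g : E → ℝ} {p : E} (hf : DifferentiableAt ℝ f p) (hg : DifferentiableAt ℝ g p)
    (h : g p ≠ 0) : DifferentiableAt ℝ (fun p => f p / g p) p := by
  simp only [div_eq_mul_inv]
  exact hf.fun_mul (hg.fun_inv h)

/-- The sign ε is a parameter so that the rule can be iterated up to the third derivative. -/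
theorem deriv_parity {g g' : ℝ → ℝ} {ρ ε : ℝ} (hg : ∀ s, |s| < ρ → HasDerivAt g (g' s) s)
    (h : ∀ s, |s| < ρ → g (-s) = ε * g s) {s : ℝ} (hs : |s| < ρ) : g' (-s) = -ε * g' s := by
  have h1 : HasDerivAt (fun s => g (-s)) (-g' (-s)) s := by
    simpa [Function.comp_def] using (hg (-s) (by rwa [abs_neg])).comp s (hasDerivAt_neg s)
  have h2 : HasDerivAt (fun s => g (-s)) (ε * g' s) s := by
    refine ((hg s hs).const_mul ε).congr_of_eventuallyEq ?_
    filter_upwards [(isOpen_lt continuous_abs continuous_const).mem_nhds hs] with r hr using h r hr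
  linarith [h1.unique h2]

/-- Hadamard's quotient `u(t, r) / r` is differentiable at `(t₀, 0)` if `u(t, 0) = 0` and the
derivative of `u_r` at `(t₀, 0)` in the direction of `r` vanishes. -/
theorem differentiableAt_div_snd {I : Set ℝ} (hI : IsOpen I) {ρ : ℝ} (hρ : 0 < ρ)
    {u v : ℝ → ℝ → ℝ} (hu : ∀ t ∈ I, ∀ r, |r| < ρ → HasDerivAt (u t) (v t r) r)
    (hu0 : ∀ t ∈ I, u t 0 = 0) {t₀ : ℝ} (ht₀ : t₀ ∈ I) {L : ℝ × ℝ →L[ℝ] ℝ}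
    (hv : HasFDerivAt (fun p : ℝ × ℝ => v p.1 p.2) L (t₀, 0)) (hL : L (0, 1) = 0) :
    DifferentiableAt ℝ (fun p : ℝ × ℝ => if p.2 = 0 then v p.1 0 else u p.1 p.2 / p.2)
      (t₀, 0) := by
  set K : ℝ × ℝ → ℝ := fun p => if p.2 = 0 then v p.1 0 else u p.1 p.2 / p.2 with hK
  -- By the mean value theorem the quotient is a value of v at a point (t, ξ) with |ξ| ≤ |r|. No
  -- continuity of ξ is needed: the bound already transports the expansion of v at (t₀, 0).
  have hex : ∀ p : ℝ × ℝ, ∃ ξ : ℝ, |ξ| ≤ |p.2| ∧ (p.1 ∈ I → |p.2| < ρ → K p = v p.1 ξ) := by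
    rintro ⟨t, r⟩
    by_cases hmem : t ∈ I ∧ |r| < ρ
    · obtain ⟨ht, hr⟩ := hmem
      rcases lt_trichotomy r 0 with h | h | h
      · have hin : ∀ s ∈ Icc r 0, |s| < ρ := fun s hs => by
          rw [abs_of_nonpos hs.2]
          rw [abs_of_neg h] at hr
          linarith [hs.1]
        obtain ⟨ξ, hξ, hξ'⟩ := exists_hasDerivAt_eq_slope (u t) (v t) h
          (fun s hs => (hu t ht s (hin s hs)).continuousAt.continuousWithinAt)
          fun s hs => hu t ht s (hin s (Ioo_subset_Icc_self hs))
        refine ⟨ξ, ?_, fun _ _ => ?_⟩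
        · rw [abs_of_neg hξ.2, abs_of_neg h]
          linarith [hξ.1]
        · simp only [hK, if_neg h.ne]
          rw [hξ', hu0 t ht, zero_sub, zero_sub, neg_div_neg_eq]
      · exact ⟨0, by simp, fun _ _ => by simp [hK, h]⟩
      · have hin : ∀ s ∈ Icc 0 r, |s| < ρ := fun s hs => by
          rw [abs_of_nonneg hs.1]
          rw [abs_of_pos h] at hr
          linarith [hs.2]
        obtain ⟨ξ, hξ, hξ'⟩ := exists_hasDerivAt_eq_slope (u t) (v t) h
          (fun s hs => (hu t ht s (hin s hs)).continuousAt.continuousWithinAt)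
          fun s hs => hu t ht s (hin s (Ioo_subset_Icc_self hs))
        refine ⟨ξ, ?_, fun _ _ => ?_⟩
        · rw [abs_of_pos hξ.1, abs_of_pos h]
          exact hξ.2.le
        · simp only [hK, if_neg h.ne']
          rw [hξ', hu0 t ht, sub_zero, sub_zero]
    · exact ⟨0, by simp, fun h1 h2 => absurd ⟨h1, h2⟩ hmem⟩
  choose ξ hξ hKξ using hex
  set Ξ : ℝ × ℝ → ℝ × ℝ := fun p => (p.1, ξ p) with hΞ
  have hbound : ∀ p : ℝ × ℝ, ‖Ξ p - (t₀, 0)‖ ≤ ‖p - (t₀, 0)‖ := by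
    intro p
    simp only [hΞ, Prod.norm_def, Prod.fst_sub, Prod.snd_sub, sub_zero, Real.norm_eq_abs]
    exact max_le_max le_rfl (hξ p)
  have htend : Filter.Tendsto Ξ (nhds (t₀, 0)) (nhds (t₀, 0)) := by
    rw [tendsto_iff_norm_sub_tendsto_zero]
    refine squeeze_zero (fun _ => norm_nonneg _) hbound ?_
    exact tendsto_iff_norm_sub_tendsto_zero.mp Filter.tendsto_id
  have hlo := (hasFDerivAt_iff_isLittleO.mp hv).comp_tendsto htend
  have hO : (fun p => Ξ p - (t₀, 0)) =O[nhds (t₀, 0)] fun p : ℝ × ℝ => p - (t₀, 0) :=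
    Asymptotics.IsBigO.of_bound 1 (Filter.Eventually.of_forall fun p => by
      rw [one_mul]; exact hbound p)
  have hlo' := hlo.trans_isBigO hO
  refine HasFDerivAt.differentiableAt (f' := L) (hasFDerivAt_iff_isLittleO.mpr
    (hlo'.congr' ?_ Filter.EventuallyEq.rfl))
  have hn : {p : ℝ × ℝ | p.1 ∈ I ∧ |p.2| < ρ} ∈ nhds (t₀, (0 : ℝ)) :=
    ((hI.preimage continuous_fst).inter
      (isOpen_lt continuous_snd.abs continuous_const)).mem_nhds ⟨ht₀, by simpa using hρ⟩
  filter_upwards [hn] with p hp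
  have h0 : K (t₀, 0) = v t₀ 0 := by simp [hK]
  have hLr : ∀ c : ℝ, L (0, c) = 0 := by
    intro c
    have : ((0 : ℝ), c) = c • ((0 : ℝ), (1 : ℝ)) := by simp
    rw [this, map_smul, hL, smul_zero]
  -- As L ignores the second coordinate, replacing r by ξ does not change the linear term.
  have hLp : ∀ a c : ℝ, L (a, c) = L (a, 0) := by
    intro a c
    have : (a, c) = (a, (0 : ℝ)) + ((0 : ℝ), c) := by simp
    rw [this, map_add, hLr, add_zero]
  simp only [Function.comp_apply, hΞ]
  rw [← hKξ p hp.1 hp.2, h0]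
  congr 1
  rw [Prod.mk_sub_mk, hLp, show p - (t₀, (0 : ℝ)) = (p.1 - t₀, p.2 - 0) from rfl, hLp _ (p.2 - 0)]

variable {k : ℕ} {I : Set ℝ} {ρ : ℝ} {F : (Fin (k + 2) → ℝ) → (Fin (k + 2) → ℝ) → ℝ}
    {φ : ℝ → ℝ → ℝ → ℝ}

theorem hasDerivAt_slice_one {f : (Fin (k + 2) → ℝ) → ℝ} {t s : ℝ}
    (hf : DifferentiableAt ℝ f (slice t s)) :
    HasDerivAt (fun s => f (slice t s)) (pd 1 f (slice t s)) s := by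
  have := hf.hasFDerivAt.comp_hasDerivAt s
    (hasDerivAt_slice (hasDerivAt_const s t) (hasDerivAt_id s))
  rw [fderiv_slice] at this
  simpa [Function.comp_def] using this

theorem hasDerivAt_slice_zero {f : (Fin (k + 2) → ℝ) → ℝ} {t s : ℝ}
    (hf : DifferentiableAt ℝ f (slice t s)) :
    HasDerivAt (fun t => f (slice t s)) (pd 0 f (slice t s)) t := by
  have := hf.hasFDerivAt.comp_hasDerivAt t
    (hasDerivAt_slice (hasDerivAt_id t) (hasDerivAt_const t s))
  rw [fderiv_slice] at this
  simpa [Function.comp_def] using this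

/-- φ is thereby a restriction of F, from which it inherits all differentiability. -/
theorem IsCylindrical.apply_slice_one (hφ : IsCylindrical I ρ F φ) {t r : ℝ} (ht : t ∈ I)
    (hr : r ∈ Ico 0 ρ) (z : ℝ) : F (slice t r) (slice z 1) = φ t r z := by
  have hx : (slice t r : Fin (k + 2) → ℝ) ∈ cyl (k + 1) I ρ :=
    slice_mem_cyl.mpr ⟨ht, by rw [abs_of_nonneg hr.1]; exact hr.2⟩
  rw [hφ _ hx _ (by rw [← norm_ne_zero_iff]; simp)]
  simp [abs_of_nonneg hr.1]

/-- If the derivatives of `F` along the slice come from diagonal connections, then `φ` satisfies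
the two differential equations. -/
theorem IsCylindrical.satisfiesBerwaldPDE (hφ : IsCylindrical I ρ F φ)
    (hF : IsFinslerMetric (cyl (k + 1) I ρ) F) (hI : IsOpen I) (hρ : 0 < ρ)
    (h : ∀ t s, (slice t s : Fin (k + 2) → ℝ) ∈ cyl (k + 1) I ρ →
      ∃ α δ : ℝ, ∀ a b, a ≠ 0 ∨ b ≠ 0 →
        pd 0 (fun w => F w (slice a b)) (slice t s)
          = α * a * pd 0 (F (slice t s)) (slice a b) ∧
        pd 1 (fun w => F w (slice a b)) (slice t s)
          = δ * b * pd 1 (F (slice t s)) (slice a b)) :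
    SatisfiesBerwaldPDE I ρ φ := by
  have hM := isOpen_cyl (n := k + 1) hI ρ
  have h10 : (1 : ℝ) ≠ 0 ∨ (0 : ℝ) ≠ 0 := Or.inl one_ne_zero
  have h01 : (0 : ℝ) ≠ 0 ∨ (1 : ℝ) ≠ 0 := Or.inr one_ne_zero
  have hz1 : ∀ z : ℝ, z ≠ 0 ∨ (1 : ℝ) ≠ 0 := fun z => Or.inr one_ne_zero
  have hmem : ∀ {t r : ℝ}, t ∈ I → |r| < ρ → (slice t r : Fin (k + 2) → ℝ) ∈ cyl (k + 1) I ρ :=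
    fun ht hr => slice_mem_cyl.mpr ⟨ht, hr⟩
  have hmem' : ∀ {t r : ℝ}, t ∈ I → r ∈ Ico 0 ρ →
      (slice t r : Fin (k + 2) → ℝ) ∈ cyl (k + 1) I ρ :=
    fun ht hr => hmem ht (by rw [abs_of_nonneg hr.1]; exact hr.2)
  have hsl : ∀ p : ℝ × ℝ, ∀ {f : (Fin (k + 2) → ℝ) → ℝ}, ContDiffAt ℝ ∞ f (slice p.1 p.2) →
      DifferentiableAt ℝ (fun p : ℝ × ℝ => f (slice p.1 p.2)) p := fun p f hf =>
    (ContDiffAt.comp (g := f) p hf contDiff_slice.contDiffAt).differentiableAt (by simp)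
  set P : (Fin (k + 2) → ℝ) → ℝ := fun w => F w (slice 1 0) with hP
  set Q : (Fin (k + 2) → ℝ) → ℝ := fun w => F w (slice 0 1) with hQ
  have hPs : ∀ x ∈ cyl (k + 1) I ρ, ContDiffAt ℝ ∞ P x := fun x hx =>
    hF.contDiffAt_base hM hx (slice_ne_zero_iff.mpr h10)
  have hQs : ∀ x ∈ cyl (k + 1) I ρ, ContDiffAt ℝ ∞ Q x := fun x hx =>
    hF.contDiffAt_base hM hx (slice_ne_zero_iff.mpr h01)
  have hPpos : ∀ x ∈ cyl (k + 1) I ρ, 0 < P x := fun x hx =>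
    hF.pos hM hx (slice_ne_zero_iff.mpr h10)
  have hQpos : ∀ x ∈ cyl (k + 1) I ρ, 0 < Q x := fun x hx =>
    hF.pos hM hx (slice_ne_zero_iff.mpr h01)
  have hQ1 : ∀ t ∈ I, ∀ r, |r| < ρ → HasDerivAt (fun s => Q (slice t s)) (pd 1 Q (slice t r)) r :=
    fun t ht r hr => hasDerivAt_slice_one ((hQs _ (hmem ht hr)).differentiableAt (by simp))
  have hQ2 : ∀ t ∈ I, ∀ r, |r| < ρ →
      HasDerivAt (fun s => pd 1 Q (slice t s)) (pd 1 (pd 1 Q) (slice t r)) r :=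
    fun t ht r hr => hasDerivAt_slice_one
      ((contDiffAt_pd (hQs _ (hmem ht hr)) 1).differentiableAt (by simp))
  have hQ3 : ∀ t ∈ I, ∀ r, |r| < ρ →
      HasDerivAt (fun s => pd 1 (pd 1 Q) (slice t s)) (pd 1 (pd 1 (pd 1 Q)) (slice t r)) r :=
    fun t ht r hr => hasDerivAt_slice_one
      ((contDiffAt_pd (contDiffAt_pd (hQs _ (hmem ht hr)) 1) 1).differentiableAt (by simp))
  have par0 : ∀ t ∈ I, ∀ r, |r| < ρ → Q (slice t (-r)) = 1 * Q (slice t r) := by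
    intro t ht r hr
    rw [one_mul]
    exact hφ.base_congr hF hI (Nat.succ_pos k) (hmem ht (by rwa [abs_neg])) (by simp) (by simp) _
  have par1 : ∀ t ∈ I, ∀ r, |r| < ρ → pd 1 Q (slice t (-r)) = -1 * pd 1 Q (slice t r) :=
    fun t ht r hr => deriv_parity (hQ1 t ht) (par0 t ht) hr
  have par2 : ∀ t ∈ I, ∀ r, |r| < ρ →
      pd 1 (pd 1 Q) (slice t (-r)) = - -1 * pd 1 (pd 1 Q) (slice t r) :=
    fun t ht r hr => deriv_parity (hQ2 t ht) (par1 t ht) hr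
  have par3 : ∀ t ∈ I, ∀ r, |r| < ρ →
      pd 1 (pd 1 (pd 1 Q)) (slice t (-r)) = - - -1 * pd 1 (pd 1 (pd 1 Q)) (slice t r) :=
    fun t ht r hr => deriv_parity (hQ3 t ht) (par2 t ht) hr
  have h0ρ : |(0 : ℝ)| < ρ := by simpa using hρ
  have hK : ∀ t ∈ I, ∀ r ∈ Ico 0 ρ, DifferentiableAt ℝ (fun p : ℝ × ℝ =>
      if p.2 = 0 then pd 1 (pd 1 Q) (slice p.1 0) else pd 1 Q (slice p.1 p.2) / p.2) (t, r) := by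
    intro t ht r hr
    rcases hr.1.eq_or_lt with h0 | h0
    · subst h0
      have hv := (hsl (t, 0) (contDiffAt_pd (contDiffAt_pd
        (hQs _ (hmem' ht hr)) 1) 1)).hasFDerivAt
      refine differentiableAt_div_snd hI hρ (u := fun t r => pd 1 Q (slice t r))
        (v := fun t r => pd 1 (pd 1 Q) (slice t r)) hQ2 (fun t ht => ?_) ht hv ?_
      · have := par1 t ht 0 h0ρ
        rw [neg_zero] at this
        linarith
      -- Q is even in r, so its third r-derivative is odd and vanishes at r = 0.
      · have hc : HasDerivAt (fun s : ℝ => (t, s)) ((0 : ℝ), (1 : ℝ)) 0 :=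
          (hasDerivAt_const (0 : ℝ) t).prodMk (hasDerivAt_id (0 : ℝ))
        have e1 := (hv.comp_hasDerivAt (0 : ℝ) hc).unique (hQ3 t ht 0 h0ρ)
        rw [e1]
        have := par3 t ht 0 h0ρ
        rw [neg_zero] at this
        linarith
    · have e : (fun p : ℝ × ℝ => if p.2 = 0 then pd 1 (pd 1 Q) (slice p.1 0)
          else pd 1 Q (slice p.1 p.2) / p.2) =ᶠ[nhds (t, r)]
          fun p => pd 1 Q (slice p.1 p.2) / p.2 := by
        filter_upwards [(isOpen_ne_fun continuous_snd continuous_const).mem_nhds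
          (show (t, r).2 ≠ 0 from h0.ne')] with p hp
        exact if_neg hp
      refine DifferentiableAt.congr_of_eventuallyEq ?_ e
      have hd := hsl (t, r) (contDiffAt_pd (hQs _ (hmem' ht hr)) 1)
      have hs : DifferentiableAt ℝ (fun p : ℝ × ℝ => p.2) (t, r) := differentiableAt_snd
      exact differentiableAt_fun_div hd hs h0.ne'
  -- On the axes the diagonal equations read Q_r = δ Q and P_t = α P. This gives g₁ = -δ/(2r) =
  -- -Q_r/(2rQ), extended to r = 0 by the limit Q_rr of Q_r/r, and g₂ = α = P_t/P.
  refine ⟨fun t r => -((if r = 0 then pd 1 (pd 1 Q) (slice t 0) else pd 1 Q (slice t r) / r)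
      / (2 * Q (slice t r))), fun t r => pd 0 P (slice t r) / P (slice t r), ?_, ?_, ?_, ?_⟩
  · rintro ⟨t, r⟩ ⟨ht, hr⟩
    have hd : DifferentiableAt ℝ (fun p : ℝ × ℝ => 2 * Q (slice p.1 p.2)) (t, r) :=
      (hsl (t, r) (hQs _ (hmem' ht hr))).const_mul 2
    exact ((differentiableAt_fun_div (hK t ht r hr) hd
      (mul_ne_zero two_ne_zero (hQpos _ (hmem' ht hr)).ne')).fun_neg).differentiableWithinAt
  · rintro ⟨t, r⟩ ⟨ht, hr⟩
    have hd := hsl (t, r) (contDiffAt_pd (hPs _ (hmem' ht hr)) 0)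
    have hd' := hsl (t, r) (hPs _ (hmem' ht hr))
    exact (differentiableAt_fun_div hd hd' (hPpos _ (hmem' ht hr)).ne').differentiableWithinAt
  · intro t ht r hr z
    have hr' : r ∈ Ico 0 ρ := Ioo_subset_Ico_self hr
    have hx := hmem' ht hr'
    obtain ⟨α, δ, hαδ⟩ := h t r hx
    have hr_deriv : deriv (fun r' => φ t r' z) r = pd 1 (fun w => F w (slice z 1)) (slice t r) := by
      refine HasDerivAt.deriv ?_
      refine (hasDerivAt_slice_one ((hF.contDiffAt_base hM hx
        (slice_ne_zero_iff.mpr (hz1 z))).differentiableAt (by simp))).congr_of_eventuallyEq ?_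
      filter_upwards [isOpen_Ioo.mem_nhds hr] with s hs
      exact (hφ.apply_slice_one ht (Ioo_subset_Ico_self hs) z).symm
    have hz_deriv : deriv (fun z' => φ t r z') z = pd 0 (F (slice t r)) (slice z 1) := by
      refine HasDerivAt.deriv ?_
      refine (hasDerivAt_slice_zero ((hF.contDiffAt_fiber hM hx
        (slice_ne_zero_iff.mpr (hz1 z))).differentiableAt (by simp))).congr_of_eventuallyEq ?_
      filter_upwards with s using (hφ.apply_slice_one ht hr' s).symm
    have e1 := (hαδ 0 1 h01).2
    have e2 := hF.euler_slice hM hx h01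
    have e3 := (hαδ z 1 (hz1 z)).2
    have e4 := hF.euler_slice hM hx (hz1 z)
    have e5 : pd 1 (F (slice t r)) (slice z 1)
        = F (slice t r) (slice z 1) - z * pd 0 (F (slice t r)) (slice z 1) := by linarith
    have e6 : pd 1 Q (slice t r) = δ * Q (slice t r) := by
      rw [show Q (slice t r) = F (slice t r) (slice 0 1) from rfl, ← e2, hQ, e1]
      ring
    have hQ0 := (hQpos _ hx).ne'
    have hr0 := hr.1.ne'
    beta_reduce
    rw [hr_deriv, hz_deriv, e3, if_neg hr0, e6, e5, hφ.apply_slice_one ht hr' z]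
    field_simp
  · intro t ht r hr z
    have hx := hmem' ht hr
    obtain ⟨α, δ, hαδ⟩ := h t r hx
    have ht_deriv : deriv (fun t' => φ t' r z) t = pd 0 (fun w => F w (slice z 1)) (slice t r) := by
      refine HasDerivAt.deriv ?_
      refine (hasDerivAt_slice_zero ((hF.contDiffAt_base hM hx
        (slice_ne_zero_iff.mpr (hz1 z))).differentiableAt (by simp))).congr_of_eventuallyEq ?_
      filter_upwards [hI.mem_nhds ht] with s hs
      exact (hφ.apply_slice_one hs hr z).symm
    have hz_deriv : deriv (fun z' => φ t r z') z = pd 0 (F (slice t r)) (slice z 1) := by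
      refine HasDerivAt.deriv ?_
      refine (hasDerivAt_slice_zero ((hF.contDiffAt_fiber hM hx
        (slice_ne_zero_iff.mpr (hz1 z))).differentiableAt (by simp))).congr_of_eventuallyEq ?_
      filter_upwards with s using (hφ.apply_slice_one ht hr s).symm
    have e1 := (hαδ 1 0 h10).1
    have e2 := hF.euler_slice hM hx h10
    have e3 := (hαδ z 1 (hz1 z)).1
    have e6 : pd 0 P (slice t r) = α * P (slice t r) := by
      rw [show P (slice t r) = F (slice t r) (slice 1 0) from rfl, ← e2, hP, e1]
      ring
    have hP0 := (hPpos _ hx).ne'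
    beta_reduce
    rw [ht_deriv, hz_deriv, e3, e6]
    field_simp

end Equations

/-! ### From the equations for φ back to a connection. -/

section Converse

theorem hasDerivAt_norm_bar {n : ℕ} {y : Fin (n + 1) → ℝ} (hy : bar y ≠ 0) (j : Fin n) :
    HasDerivAt (fun s : ℝ => ‖bar (y + s • Pi.single j.succ (1 : ℝ))‖) (y j.succ / ‖bar y‖) 0 := by
  have hn : ‖bar y‖ ≠ 0 := norm_ne_zero_iff.mpr hy
  have h1 : ∀ s : ℝ, ‖bar (y + s • Pi.single j.succ (1 : ℝ))‖
      = √(‖bar y‖ ^ 2 + 2 * (s * y j.succ) + s ^ 2) := by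
    intro s
    have h0 : ‖bar (y + s • Pi.single j.succ (1 : ℝ))‖ ^ 2
        = ‖bar y‖ ^ 2 + 2 * (s * y j.succ) + s ^ 2 := by
      rw [bar_add, bar_smul, bar_single_succ, norm_add_sq_real, inner_smul_right,
        EuclideanSpace.inner_single_right, norm_smul, mul_pow, Real.norm_eq_abs, sq_abs]
      simp [bar_apply]
    rw [← h0, Real.sqrt_sq (norm_nonneg _)]
  have h2 : HasDerivAt (fun s : ℝ => ‖bar y‖ ^ 2 + 2 * (s * y j.succ) + s ^ 2) (2 * y j.succ) 0 := by
    have := ((((hasDerivAt_id (0 : ℝ)).mul_const (y j.succ)).const_mul 2).const_add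
      (‖bar y‖ ^ 2)).fun_add (hasDerivAt_pow 2 (0 : ℝ))
    simpa using this
  have h3 := h2.sqrt (by simpa using hn)
  rw [funext h1]
  refine h3.congr_deriv ?_
  have : √(‖bar y‖ ^ 2 + 2 * (0 * y j.succ) + 0 ^ 2) = ‖bar y‖ := by
    simp
  rw [this]
  field_simp

variable {k : ℕ} {I : Set ℝ} {ρ : ℝ} {F : (Fin (k + 2) → ℝ) → (Fin (k + 2) → ℝ) → ℝ}
    {φ : ℝ → ℝ → ℝ → ℝ} {x y : Fin (k + 2) → ℝ}

section Derivatives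

variable (hφ : IsCylindrical I ρ F φ) (hF : IsFinslerMetric (cyl (k + 1) I ρ) F) (hI : IsOpen I)
include hφ hF hI

theorem IsCylindrical.differentiableAt_fst {t r : ℝ} (ht : t ∈ I) (hr : r ∈ Ico 0 ρ) (z : ℝ) :
    DifferentiableAt ℝ (fun t' => φ t' r z) t := by
  have hM := isOpen_cyl (n := k + 1) hI ρ
  have hx : (slice t r : Fin (k + 2) → ℝ) ∈ cyl (k + 1) I ρ :=
    slice_mem_cyl.mpr ⟨ht, by rw [abs_of_nonneg hr.1]; exact hr.2⟩
  refine (hasDerivAt_slice_zero ((hF.contDiffAt_base hM hx (slice_ne_zero_iff.mpr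
    (Or.inr one_ne_zero : z ≠ 0 ∨ (1 : ℝ) ≠ 0))).differentiableAt
    (by simp))).differentiableAt.congr_of_eventuallyEq ?_
  filter_upwards [hI.mem_nhds ht] with s hs using (hφ.apply_slice_one hs hr z).symm

theorem IsCylindrical.differentiableAt_snd {t r : ℝ} (ht : t ∈ I) (hr : r ∈ Ioo 0 ρ) (z : ℝ) :
    DifferentiableAt ℝ (fun r' => φ t r' z) r := by
  have hM := isOpen_cyl (n := k + 1) hI ρ
  have hx : (slice t r : Fin (k + 2) → ℝ) ∈ cyl (k + 1) I ρ :=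
    slice_mem_cyl.mpr ⟨ht, by rw [abs_of_pos hr.1]; exact hr.2⟩
  refine (hasDerivAt_slice_one ((hF.contDiffAt_base hM hx (slice_ne_zero_iff.mpr
    (Or.inr one_ne_zero : z ≠ 0 ∨ (1 : ℝ) ≠ 0))).differentiableAt
    (by simp))).differentiableAt.congr_of_eventuallyEq ?_
  filter_upwards [isOpen_Ioo.mem_nhds hr] with s hs
  exact (hφ.apply_slice_one ht (Ioo_subset_Ico_self hs) z).symm

theorem IsCylindrical.differentiableAt_thd {t r : ℝ} (ht : t ∈ I) (hr : r ∈ Ico 0 ρ) (z : ℝ) :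
    DifferentiableAt ℝ (fun z' => φ t r z') z := by
  have hM := isOpen_cyl (n := k + 1) hI ρ
  have hx : (slice t r : Fin (k + 2) → ℝ) ∈ cyl (k + 1) I ρ :=
    slice_mem_cyl.mpr ⟨ht, by rw [abs_of_nonneg hr.1]; exact hr.2⟩
  refine (hasDerivAt_slice_zero ((hF.contDiffAt_fiber hM hx (slice_ne_zero_iff.mpr
    (Or.inr one_ne_zero : z ≠ 0 ∨ (1 : ℝ) ≠ 0))).differentiableAt
    (by simp))).differentiableAt.congr_of_eventuallyEq ?_
  filter_upwards with s using (hφ.apply_slice_one ht hr s).symm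

theorem IsCylindrical.pd_base_zero (hx : x ∈ cyl (k + 1) I ρ) (hy : bar y ≠ 0) :
    pd 0 (fun w => F w y) x
      = ‖bar y‖ * deriv (fun t => φ t ‖bar x‖ (y 0 / ‖bar y‖)) (x 0) := by
  have hM := isOpen_cyl (n := k + 1) hI ρ
  have hy0 : y ≠ 0 := fun h => hy (by rw [h]; rfl)
  refine pd_eq_of_hasDerivAt ((hF.contDiffAt_base hM hx hy0).differentiableAt (by simp)) ?_
  have h1 := (hφ.differentiableAt_fst hF hI hx.1 ⟨norm_nonneg (bar x), hx.2⟩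
    (y 0 / ‖bar y‖)).hasDerivAt
  have h2 : HasDerivAt (fun s : ℝ => x 0 + s) 1 0 := (hasDerivAt_id (0 : ℝ)).const_add (x 0)
  have h3 := (h1.comp_of_eq (0 : ℝ) h2 (by simp)).const_mul ‖bar y‖
  rw [mul_one] at h3
  refine h3.congr_of_eventuallyEq ?_
  have hc : ContinuousAt (fun s : ℝ => x + s • (Pi.single 0 1 : Fin (k + 2) → ℝ)) 0 := by fun_prop
  filter_upwards [hc.preimage_mem_nhds (by simpa using hM.mem_nhds hx)] with s hs
  rw [hφ _ hs y hy, bar_add, bar_smul, bar_single_zero]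
  simp

theorem IsCylindrical.pd_base_succ (hx : x ∈ cyl (k + 1) I ρ) (hx0 : bar x ≠ 0) (hy : bar y ≠ 0)
    (i : Fin (k + 1)) :
    pd i.succ (fun w => F w y) x
      = ‖bar y‖ * (deriv (fun r => φ (x 0) r (y 0 / ‖bar y‖)) ‖bar x‖
        * (x i.succ / ‖bar x‖)) := by
  have hM := isOpen_cyl (n := k + 1) hI ρ
  have hy0 : y ≠ 0 := fun h => hy (by rw [h]; rfl)
  refine pd_eq_of_hasDerivAt ((hF.contDiffAt_base hM hx hy0).differentiableAt (by simp)) ?_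
  have h1 := (hφ.differentiableAt_snd hF hI hx.1 ⟨norm_pos_iff.mpr hx0, hx.2⟩
    (y 0 / ‖bar y‖)).hasDerivAt
  have h3 := (h1.comp_of_eq (0 : ℝ)
    (hasDerivAt_norm_bar hx0 i) (by simp)).const_mul ‖bar y‖
  refine h3.congr_of_eventuallyEq ?_
  have hc : ContinuousAt (fun s : ℝ => x + s • (Pi.single i.succ 1 : Fin (k + 2) → ℝ)) 0 := by
    fun_prop
  filter_upwards [hc.preimage_mem_nhds (by simpa using hM.mem_nhds hx)] with s hs
  rw [hφ _ hs y hy, add_smul_single_apply_zero (Fin.succ_ne_zero i)]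
  rfl

/-- On the axis |x̄| is not differentiable, so the chain rule is replaced by evenness of F in x^i.
-/
theorem IsCylindrical.pd_base_succ_of_bar_eq_zero (hx : x ∈ cyl (k + 1) I ρ) (hx0 : bar x = 0)
    (hy : y ≠ 0) (i : Fin (k + 1)) : pd i.succ (fun w => F w y) x = 0 := by
  have hM := isOpen_cyl (n := k + 1) hI ρ
  have hxi : x i.succ = 0 := by rw [← bar_apply x, hx0]; rfl
  have hd := hasDerivAt_pd ((hF.contDiffAt_base hM hx hy).differentiableAt (by simp)) i.succ
  refine hasDerivAt_even_zero hd ?_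
  have hc : ContinuousAt (fun s : ℝ => x + (-s) • (Pi.single i.succ 1 : Fin (k + 2) → ℝ)) 0 := by
    fun_prop
  filter_upwards [hc.preimage_mem_nhds (by simpa using hM.mem_nhds hx)] with s hs
  refine hφ.base_congr hF hI (Nat.succ_pos k) hs ?_ ?_ y
  · rw [add_smul_single_apply_zero (Fin.succ_ne_zero i),
      add_smul_single_apply_zero (Fin.succ_ne_zero i)]
  · exact norm_bar_add_eq_norm_bar_sub (Fin.succ_ne_zero i) hxi s

theorem IsCylindrical.pd_fiber_zero (hx : x ∈ cyl (k + 1) I ρ) (hy : bar y ≠ 0) :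
    pd 0 (F x) y = deriv (fun z => φ (x 0) ‖bar x‖ z) (y 0 / ‖bar y‖) := by
  have hM := isOpen_cyl (n := k + 1) hI ρ
  have hy0 : y ≠ 0 := fun h => hy (by rw [h]; rfl)
  have hn : ‖bar y‖ ≠ 0 := norm_ne_zero_iff.mpr hy
  refine pd_eq_of_hasDerivAt ((hF.contDiffAt_fiber hM hx hy0).differentiableAt (by simp)) ?_
  have h1 := (hφ.differentiableAt_thd hF hI hx.1 ⟨norm_nonneg (bar x), hx.2⟩
    (y 0 / ‖bar y‖)).hasDerivAt
  have h2 : HasDerivAt (fun s : ℝ => (y 0 + s) / ‖bar y‖) (1 / ‖bar y‖) 0 :=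
    ((hasDerivAt_id (0 : ℝ)).const_add (y 0)).div_const _
  have h3 := (h1.comp_of_eq (0 : ℝ) h2 (by simp)).const_mul ‖bar y‖
  have h4 : ∀ s : ℝ, bar (y + s • Pi.single 0 (1 : ℝ)) = bar y := fun s => by
    rw [bar_add, bar_smul, bar_single_zero, smul_zero, add_zero]
  refine (h3.congr_deriv (by field_simp)).congr_of_eventuallyEq ?_
  filter_upwards with s
  rw [hφ x hx _ (by rw [h4]; exact hy), h4]
  simp

theorem IsCylindrical.pd_fiber_succ (hx : x ∈ cyl (k + 1) I ρ) (hy : bar y ≠ 0)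
    (j : Fin (k + 1)) :
    pd j.succ (F x) y = y j.succ / ‖bar y‖ * (φ (x 0) ‖bar x‖ (y 0 / ‖bar y‖)
      - y 0 / ‖bar y‖ * deriv (fun z => φ (x 0) ‖bar x‖ z) (y 0 / ‖bar y‖)) := by
  have hM := isOpen_cyl (n := k + 1) hI ρ
  have hy0 : y ≠ 0 := fun h => hy (by rw [h]; rfl)
  have hn : ‖bar y‖ ≠ 0 := norm_ne_zero_iff.mpr hy
  refine pd_eq_of_hasDerivAt ((hF.contDiffAt_fiber hM hx hy0).differentiableAt (by simp)) ?_
  have h1 := (hφ.differentiableAt_thd hF hI hx.1 ⟨norm_nonneg (bar x), hx.2⟩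
    (y 0 / ‖bar y‖)).hasDerivAt
  have hu := hasDerivAt_norm_bar hy j
  have hu0 : ‖bar (y + (0 : ℝ) • Pi.single j.succ (1 : ℝ))‖ = ‖bar y‖ := by simp
  have h2 := (hasDerivAt_const (0 : ℝ) (y 0)).fun_div hu (by rw [hu0]; exact hn)
  have h3 := hu.fun_mul (h1.comp_of_eq (0 : ℝ) h2 (by rw [hu0]))
  rw [hu0] at h3
  refine (h3.congr_deriv ?_).congr_of_eventuallyEq ?_
  · simp only [Function.comp_apply, hu0]
    field_simp
    ring
  · filter_upwards [hu.continuousAt.eventually_ne (by rw [hu0]; exact hn)] with s hs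
    rw [hφ x hx _ (norm_ne_zero_iff.mp hs), add_smul_single_apply_zero (Fin.succ_ne_zero j)]
    rfl

end Derivatives

/-- The Christoffel symbols of the connection that comes from the two differential equations. -/
def christoffel (x : Fin (k + 2) → ℝ) (c₁ c₂ : ℝ) (A B C : Fin (k + 2)) : ℝ :=
  Fin.cases (motive := fun _ => ℝ)
    (Fin.cases (motive := fun _ => ℝ) (Fin.cases (motive := fun _ => ℝ) c₂ (fun _ => 0) C)
      (fun _ => 0) B)
    (fun j => Fin.cases (motive := fun _ => ℝ) 0
      (fun i => Fin.cases (motive := fun _ => ℝ) 0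
        (fun l => -2 * c₁ * (x i.succ * (1 : Matrix _ _ ℝ) j l
          + x l.succ * (1 : Matrix _ _ ℝ) j i - x j.succ * (1 : Matrix _ _ ℝ) i l)) C) B) A

theorem christoffel_symm (x : Fin (k + 2) → ℝ) (c₁ c₂ : ℝ) (A B C : Fin (k + 2)) :
    christoffel x c₁ c₂ A B C = christoffel x c₁ c₂ A C B := by
  induction A using Fin.cases <;> induction B using Fin.cases <;> induction C using Fin.cases <;>
    simp only [christoffel, Fin.cases_zero, Fin.cases_succ]
  rename_i j i l
  rw [show (1 : Matrix (Fin (k + 1)) (Fin (k + 1)) ℝ) i l = (1 : Matrix _ _ ℝ) l i by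
    simp only [Matrix.one_apply, eq_comm]]
  ring

/-- The equations give F_{x^0} = g₂ y^0 F_{y^0} and F_{x^i} = -2 g₁ x^i y^j F_{y^j} (spatial j). The
connection read off from this is not symmetric in its spatial lower indices; `christoffel` adds the
terms with x^l δ_{ji} - x^j δ_{il}, which restore symmetry and contract to zero because F_{y^j} is
proportional to y^j. -/
theorem IsCylindrical.isBerwald_of_satisfiesBerwaldPDE (hφ : IsCylindrical I ρ F φ)
    (hF : IsFinslerMetric (cyl (k + 1) I ρ) F) (hI : IsOpen I)
    (h : SatisfiesBerwaldPDE I ρ φ) : IsBerwald (cyl (k + 1) I ρ) F := by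
  have hM := isOpen_cyl (n := k + 1) hI ρ
  obtain ⟨g₁, g₂, -, -, h₁, h₂⟩ := h
  intro x hx y hy A B C D
  refine hF.berwaldCurvature_eq_zero hM hx
    (christoffel_symm x (g₁ (x 0) ‖bar x‖) (g₂ (x 0) ‖bar x‖)) (fun y hy B => ?_) hy A B C D
  have hcont : ∀ v, v ≠ 0 → ContinuousAt (fun v => ∑ A, pd A (F x) v *
      ∑ C, christoffel x (g₁ (x 0) ‖bar x‖) (g₂ (x 0) ‖bar x‖) A B C * v C) v := by
    intro v hv
    refine tendsto_finsetSum _ fun A _ => ?_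
    exact (contDiffAt_pd (hF.contDiffAt_fiber hM hx hv) A).continuousAt.mul
      (tendsto_finsetSum _ fun C _ => (continuous_const.mul (continuous_apply C)).continuousAt)
  -- Both sides are continuous in y ≠ 0, so axial vectors, where φ is unavailable, may be left out.
  refine eq_of_eq_of_bar_ne_zero (Nat.succ_pos k)
    (fun v hv => (hF.contDiffAt_pd_base hM hx hv B).continuousAt) hcont (fun y hy => ?_) hy
  have hn : ‖bar y‖ ≠ 0 := norm_ne_zero_iff.mpr hy
  have hy0 : y ≠ 0 := fun h => hy (by rw [h]; rfl)
  set z := y 0 / ‖bar y‖ with hz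
  set d := φ (x 0) ‖bar x‖ z - z * deriv (fun z => φ (x 0) ‖bar x‖ z) z with hd
  have hsucc : ∀ j : Fin (k + 1), pd j.succ (F x) y = d / ‖bar y‖ * y j.succ := by
    intro j
    rw [hφ.pd_fiber_succ hF hI hx hy]
    ring
  have hsq : ∑ j : Fin (k + 1), y j.succ * y j.succ = ‖bar y‖ ^ 2 := by
    rw [EuclideanSpace.real_norm_sq_eq]
    exact Finset.sum_congr rfl fun j _ => by rw [bar_apply]; ring
  induction B using Fin.cases with
  | zero =>
    rw [hφ.pd_base_zero hF hI hx hy, h₂ _ hx.1 _ ⟨norm_nonneg _, hx.2⟩, Fin.sum_univ_succ,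
      Fin.sum_univ_succ]
    simp only [christoffel, Fin.cases_zero, Fin.cases_succ, zero_mul, Finset.sum_const_zero,
      mul_zero, add_zero]
    rw [hφ.pd_fiber_zero hF hI hx hy, ← hz, show y 0 = z * ‖bar y‖ by rw [hz]; field_simp]
    ring
  | succ i =>
    have hlhs : pd i.succ (fun w => F w y) x
        = -2 * g₁ (x 0) ‖bar x‖ * x i.succ * (‖bar y‖ * d) := by
      by_cases hx0 : bar x = 0
      · rw [hφ.pd_base_succ_of_bar_eq_zero hF hI hx hx0 hy0, ← bar_apply x, hx0]
        simp
      · have hr := norm_pos_iff.mpr hx0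
        have := h₁ _ hx.1 _ ⟨hr, hx.2⟩ z
        rw [hφ.pd_base_succ hF hI hx hx0 hy]
        rw [div_eq_iff hr.ne'] at this
        rw [neg_eq_iff_eq_neg.mp this, ← hd]
        field_simp
    have hinner : ∀ j : Fin (k + 1), ∑ C, christoffel x (g₁ (x 0) ‖bar x‖) (g₂ (x 0) ‖bar x‖)
        j.succ i.succ C * y C = -2 * g₁ (x 0) ‖bar x‖ * (x i.succ * y j.succ
          + (∑ l : Fin (k + 1), x l.succ * y l.succ) * (1 : Matrix _ _ ℝ) j i
          - x j.succ * y i.succ) := by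
      intro j
      rw [Fin.sum_univ_succ]
      simp only [christoffel, Fin.cases_zero, Fin.cases_succ, zero_mul, zero_add]
      calc _ = -2 * g₁ (x 0) ‖bar x‖ * (x i.succ * ∑ l : Fin (k + 1), (1 : Matrix _ _ ℝ) j l * y l.succ
            + (∑ l : Fin (k + 1), x l.succ * y l.succ) * (1 : Matrix _ _ ℝ) j i
            - x j.succ * ∑ l : Fin (k + 1), (1 : Matrix _ _ ℝ) i l * y l.succ) := by
            rw [Finset.mul_sum, Finset.sum_mul, Finset.mul_sum, ← Finset.sum_add_distrib,
              ← Finset.sum_sub_distrib, Finset.mul_sum]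
            exact Finset.sum_congr rfl fun l _ => by ring
        _ = _ := by simp [Matrix.one_apply]
    have hzero : ∑ C, christoffel x (g₁ (x 0) ‖bar x‖) (g₂ (x 0) ‖bar x‖) 0 i.succ C * y C = 0 := by
      simp [christoffel]
    rw [Fin.sum_univ_succ, hzero, mul_zero, zero_add]
    simp only [hinner, hsucc, hlhs]
    have e1 : ∑ j : Fin (k + 1), y j.succ * (1 : Matrix _ _ ℝ) j i = y i.succ := by
      simp [Matrix.one_apply]
    -- The last two summands are the contracted symmetrizing terms, which cancel.
    calc _ = -2 * g₁ (x 0) ‖bar x‖ * (d / ‖bar y‖) * (x i.succ * ‖bar y‖ ^ 2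
          + (∑ l : Fin (k + 1), x l.succ * y l.succ) * y i.succ
          - (∑ l : Fin (k + 1), x l.succ * y l.succ) * y i.succ) := by
          field_simp
          ring
      _ = _ := by
          conv_lhs => enter [2, 1, 1]; rw [← hsq]
          conv_lhs => enter [2, 1, 2]; rw [← e1]
          rw [Finset.mul_sum, Finset.mul_sum, Finset.sum_mul, ← Finset.sum_add_distrib,
            ← Finset.sum_sub_distrib, Finset.mul_sum]
          exact Finset.sum_congr rfl fun j _ => by ring

end Converse

end FinslerCyl

/-! ### The equivalence. -/

theorem mainTheorem7 (n : ℕ) (hn : 3 ≤ n) (I : Set ℝ) (hIo : IsOpen I) (hIc : I.OrdConnected)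
    (hIn : I.Nonempty) (ρ : ℝ) (hρ : 0 < ρ)
    (F : (Fin (n + 1) → ℝ) → (Fin (n + 1) → ℝ) → ℝ) (φ : ℝ → ℝ → ℝ → ℝ)
    (hF : FinslerCyl.IsFinslerMetric (FinslerCyl.cyl n I ρ) F)
    (hφ : ∀ x ∈ FinslerCyl.cyl n I ρ, ∀ y : Fin (n + 1) → ℝ, FinslerCyl.bar y ≠ 0 →
      F x y = ‖FinslerCyl.bar y‖ * φ (x 0) ‖FinslerCyl.bar x‖ (y 0 / ‖FinslerCyl.bar y‖)) :
    FinslerCyl.IsBerwald (FinslerCyl.cyl n I ρ) F ↔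
      ((FinslerCyl.IsBerwald (FinslerCyl.cyl n I ρ) F ∧
          FinslerCyl.IsRanders (FinslerCyl.cyl n I ρ) F) ∨
        FinslerCyl.SatisfiesBerwaldPDE I ρ φ) := by
  obtain ⟨k, rfl⟩ : ∃ k, n = k + 1 := ⟨n - 1, by omega⟩
  have hcyl : FinslerCyl.IsCylindrical I ρ F φ := hφ
  constructor
  · intro hB
    -- One Euclidean point makes the whole slice Euclidean; if there is none, the diagonal
    -- alternative holds at every point of the slice.
    by_cases hE : ∃ t s, (FinslerCyl.slice t s : Fin (k + 2) → ℝ) ∈ FinslerCyl.cyl (k + 1) I ρ ∧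
        FinslerCyl.IsEuclideanAt F (FinslerCyl.slice t s)
    · obtain ⟨t, s, hx, hE⟩ := hE
      exact Or.inl ⟨hB, hcyl.isRanders_of_isEuclideanAt hF hIo fun t' s' hx' =>
        hcyl.isEuclideanAt_of_isEuclideanAt hF hIo hIc hB hx hx' hE⟩
    · push Not at hE
      exact Or.inr (hcyl.satisfiesBerwaldPDE hF hIo hρ fun t s hx =>
        (hcyl.isEuclideanAt_or hF hIo hx (hB _ hx)).resolve_left (hE t s hx))
  · rintro (h | h)
    · exact h.1
    · exact hcyl.isBerwald_of_satisfiesBerwaldPDE hF hIo h
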